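/- Let $E$ be a Polish space and let $(X_t,(\mathbb P_x)_{x\in E})_{t\ge 0}$ be a conservative time-homogeneous Markov process on $E$, jointly measurable in $(t,\omega)$, with transition semigroup $P_tf(x)=\mathbb E_x[f(X_t)]$. Let $\mu$ be an invariant probability measure, let $(P_t)$ be strongly continuous on $\mathbb L^2(\mu)$ with infinitesimal generator $L$ and domain $D(L)\subset\mathbb L^2(\mu)$, and write $\langle f,g\rangle_\mu=\int fg\,d\mu$. For a probability measure $\nu$ on $E$ put $\mathbb P_\nu=\int\mathbb P_x\,\nu(dx)$. Let $F$ be a real function on $]0,+\infty[$ that is continuous, strictly increasing and concave, with $F(x)\to+\infty$ as $x\to+\infty$, $F(1)=0$, and $F(xy)\le F(x)+F(y)$ for all $x,y>0$. Let $F(0)\in[-\infty,0[$ be its limit at $0^+$ and let $F^{-1}:\,]F(0),+\infty[\,\to\,]0,+\infty[$ be its inverse; put $F(+\infty)=+\infty$. Assume that $\mu$ satisfies the $F$-Sobolev inequality $$\int f^2F(f^2)\,d\mu\le-\langle Lf,f\rangle_\mu\qquad\text{for all } f\in D(L)\text{ with }\int f^2\,d\mu=1,$$ where the integrand is $0$ wherever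 $f=0$ (the left-hand side being in particular finite), and, for some $C_P>0$, the Poincar\'e inequality $$\mathrm{Var}_\mu(f)\le-C_P\langle Lf,f\rangle_\mu\qquad\text{for all } f\in D(L).$$ Let $V:E\to\mathbb R$ be measurable with $\int V\,d\mu=0$ and $\int V^2\,d\mu=m^2<+\infty$, let $V^+=\max(V,0)$, and assume that $\int F^{-1}(\lambda_0V^+)\,d\mu<+\infty$ for some $\lambda_0>0$. Define $$\lambda_1=\sup\left\{0<\lambda\le\lambda_0\;;\;F\left(\int F^{-1}\left(2\lambda V\,\mathbf 1_{\{\lambda V>1/(4C_P)\}}\right)d\mu\right)\le\frac1{4C_P}\right\},$$ $$I(R)=\sup_{0\le\lambda\le\lambda_1}\left(R\lambda-8m^2C_P\lambda^2\right).$$ Then: 1. $0<\lambda_1\le\lambda_0$. 2. For every probability measure $\nu\ll\mu$ and every $t>0$, the function $s\mapsto V(X_s)$ is $\mathbb P_\nu$-almost surely integrable on $[0,t]$, and for all $R>0$ $$\mathbb P_\nu\left(\frac1t\int_0^tV(X_s)\,ds\ge R\right)\le\left\|\frac{d\nu}{d\mu}\right\|_{\mathbb L^2(\mu)}\exp\left(-t\,I(R)\right),$$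 the right-hand side being $+\infty$ when $d\nu/d\mu\notin\mathbb L^2(\mu)$. 3. The bound is Gaussian for small $R$ and exponential for large $R$: for $R>0$, $I(R)=R^2/(32m^2C_P)$ if $R\le16m^2C_P\lambda_1$, and $I(R)=\lambda_1R-8m^2C_P\lambda_1^2$ if $R\ge16m^2C_P\lambda_1$. -/

import Mathlib

open MeasureTheory ProbabilityTheory Set Filter Topology
open scoped NNReal ENNReal

noncomputable section

/-- A conservative, time-homogeneous, continuous-time Markov process `(X_t, (ℙ_x)_{x ∈ E})` with
state space `E`, realised on a measurable space `Ω` and jointly measurable in time and sample.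
Conservativeness is the fact that `X` takes its values in `E` at all times and that every `ℙ_x` is
a probability measure. -/
structure MarkovProcess (E Ω : Type*) [MeasurableSpace E] [MeasurableSpace Ω] where
  /-- The process `X_t(ω)`. -/
  X : ℝ≥0 → Ω → E
  /-- The laws `ℙ_x` on `Ω`. -/
  law : Kernel E Ω
  measurable_X : Measurable (fun p : ℝ≥0 × Ω => X p.1 p.2)
  isMarkovKernel_law : IsMarkovKernel law
  /-- `X_0 = x` almost surely under `ℙ_x`. -/
  start : ∀ x, ∀ᵐ ω ∂(law x), X 0 ω = x
  /-- The Markov property with respect to the natural filtration `σ(X_r, r ≤ s)`: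
  `ℙ_x(B, X_{s+t} ∈ A) = 𝔼_x[1_B ℙ_{X_s}(X_t ∈ A)]`. -/
  markov : ∀ (x : E) (s t : ℝ≥0) (B : Set Ω) (A : Set E),
    MeasurableSet[⨆ r : Set.Iic s, MeasurableSpace.comap (X r) inferInstance] B →
    MeasurableSet A →
      law x (B ∩ X (s + t) ⁻¹' A) = ∫⁻ ω in B, law (X s ω) (X t ⁻¹' A) ∂(law x)

namespace MarkovProcess

variable {E Ω : Type*} [MeasurableSpace E] [MeasurableSpace Ω]

/-- The law `ℙ_ν = ∫ ℙ_x ν(dx)` of the process with initial distribution `ν`. -/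
def lawFrom (M : MarkovProcess E Ω) (ν : Measure E) : Measure Ω := ν.bind M.law

/-- The transition kernel `P_t(x, A) = ℙ_x(X_t ∈ A)`. -/
def transition (M : MarkovProcess E Ω) (t : ℝ≥0) : Kernel E E := M.law.map (M.X t)

/-- The semigroup `P_t f(x) = 𝔼_x[f(X_t)]`. -/
def semigroup (M : MarkovProcess E Ω) (t : ℝ≥0) (f : E → ℝ) (x : E) : ℝ :=
  ∫ y, f y ∂(M.transition t x)

/-- `μ` is invariant: `μ P_t = μ` for all `t`. -/
def IsInvariant (M : MarkovProcess E Ω) (μ : Measure E) : Prop :=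
  ∀ t, Kernel.Invariant (M.transition t) μ

/-- The semigroup is strongly continuous on `L²(μ)`. -/
def IsStronglyContinuous (M : MarkovProcess E Ω) (μ : Measure E) : Prop :=
  ∀ f : E → ℝ, MemLp f 2 μ →
    Tendsto (fun t : ℝ≥0 => eLpNorm (fun x => M.semigroup t f x - f x) 2 μ) (𝓝[>] 0) (𝓝 0)

/-- The graph of the infinitesimal generator `L` of the semigroup on `L²(μ)`: `f ∈ D(L)` and
`L f = g`, that is, `(P_t f - f) / t → g` in `L²(μ)` as `t ↓ 0`. -/
def GeneratorGraph (M : MarkovProcess E Ω) (μ : Measure E) (f g : E → ℝ) : Prop :=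
  MemLp f 2 μ ∧ MemLp g 2 μ ∧
    Tendsto (fun t : ℝ≥0 =>
      eLpNorm (fun x => (t : ℝ)⁻¹ * (M.semigroup t f x - f x) - g x) 2 μ) (𝓝[>] 0) (𝓝 0)

/-- The Poincaré inequality `Var_μ(f) ≤ - C ⟨L f, f⟩_μ` for all `f ∈ D(L)`. -/
def Poincare (M : MarkovProcess E Ω) (μ : Measure E) (C : ℝ) : Prop :=
  ∀ f g : E → ℝ, M.GeneratorGraph μ f g → variance f μ ≤ - C * ∫ x, g x * f x ∂μ

/-- The `F`-Sobolev inequality `∫ f² F(f²) dμ ≤ - ⟨L f, f⟩_μ` for all `f ∈ D(L)` with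
`∫ f² dμ = 1`; at points where `f = 0` the integrand is `0`. The integral on the left is
required to converge. -/
def FSobolev (M : MarkovProcess E Ω) (μ : Measure E) (F : ℝ → ℝ) : Prop :=
  ∀ f g : E → ℝ, M.GeneratorGraph μ f g → ∫ x, f x ^ 2 ∂μ = 1 →
    Integrable (fun x => f x ^ 2 * F (f x ^ 2)) μ ∧
      ∫ x, f x ^ 2 * F (f x ^ 2) ∂μ ≤ - ∫ x, g x * f x ∂μ

end MarkovProcess

/-- The standing assumptions on `F`. Only the values on `]0, +∞[` matter, and `F(0)` is understood
as the limit at `0+`, which may be `-∞` (as for `F = log`). -/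
structure IsSobolevFunction (F : ℝ → ℝ) : Prop where
  continuousOn : ContinuousOn F (Ioi 0)
  strictMonoOn : StrictMonoOn F (Ioi 0)
  concaveOn : ConcaveOn ℝ (Ioi 0) F
  tendsto_atTop : Tendsto F atTop atTop
  map_one : F 1 = 0
  map_mul_le : ∀ x y : ℝ, 0 < x → 0 < y → F (x * y) ≤ F x + F y

/-- The inverse function `F⁻¹ : ]F(0), +∞[ → ]0, +∞[` of `F`. -/
def sobolevInv (F : ℝ → ℝ) : ℝ → ℝ := Function.invFunOn F (Ioi 0)

/-- The function `2 l V 1_{l V > 1 / (4 C)}`. -/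
def truncatedPotential {E : Type*} (V : E → ℝ) (C l : ℝ) : E → ℝ :=
  {x | 1 / (4 * C) < l * V x}.indicator (fun x => 2 * l * V x)

/-- `λ₁ = sup {0 < l ≤ l₀ : F(∫ F⁻¹(2 l V 1_{l V > 1 / (4 C)}) dμ) ≤ 1 / (4 C)}`, where
`F(+∞) = +∞`, so that the integral has to be finite. -/
def lambdaOne {E : Type*} [MeasurableSpace E] (μ : Measure E) (F : ℝ → ℝ) (V : E → ℝ)
    (C l₀ : ℝ) : ℝ :=
  sSup {l : ℝ | 0 < l ∧ l ≤ l₀ ∧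
    Integrable (fun x => sobolevInv F (truncatedPotential V C l x)) μ ∧
    F (∫ x, sobolevInv F (truncatedPotential V C l x) ∂μ) ≤ 1 / (4 * C)}

/-- `sup_{0 ≤ l ≤ l₁} (R l - 8 m² C l²)`. -/
def deviationRate (m C l₁ R : ℝ) : ℝ :=
  sSup ((fun l : ℝ => R * l - 8 * m ^ 2 * C * l ^ 2) '' Icc 0 l₁)

end

/-!
By Chebyshev's inequality it suffices to bound the exponential moments of `l ∫_0^t V(X_s) ds`,
first for a bounded truncation `W` of `l V`. The Feynman–Kac function
`u_t(x) = 𝔼_x[exp(∫_0^t W(X_s) ds)]` solves `∂_t u = L u + W u`, so `‖u_t‖²` grows at most like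
`exp(2 Λ t)`, where `Λ` bounds the quadratic form of `L + W`.

To find `Λ`, write `f = a + h` with `a` the mean of `f`. The term in `h²` is absorbed by half of
`-⟨L f, f⟩`: below the level `1 / (4 C)` the potential is handled by the Poincaré inequality, and
above it by the `F`-Sobolev inequality, since a concave `F` with `F(x y) ≤ F(x) + F(y)` satisfies
the Gibbs-type inequality `∫ U h² ≤ ∫ h² F(h²) + F(∫ F⁻¹(U))` for `∫ h² = 1`. Young's inequality and
the Poincaré inequality absorb the cross term and leave `8 C ∫ W²`, which is `8 m² C l²` in the
limit.
-/

noncomputable section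

section Moments

variable {α Ω Ω' : Type*} [MeasurableSpace α] [MeasurableSpace Ω] [MeasurableSpace Ω']

theorem lintegral_fin_prod_eq_pow (ρ : Measure α) [SigmaFinite ρ] {f : α → ℝ≥0∞}
    (hf : Measurable f) (n : ℕ) :
    ∫⁻ σ : Fin n → α, ∏ i, f (σ i) ∂(Measure.pi fun _ => ρ) = (∫⁻ a, f a ∂ρ) ^ n := by
  induction n with
  | zero => simp
  | succ n ih =>
    rw [← ((measurePreserving_piFinSuccAbove (fun _ : Fin (n + 1) => ρ) 0).symm).lintegral_comp_emb
      (MeasurableEquiv.measurableEmbedding _)]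
    simp_rw [MeasurableEquiv.piFinSuccAbove_symm_apply, Fin.insertNthEquiv, Fin.prod_univ_succ,
      Fin.insertNth_zero, Equiv.coe_fn_mk, Fin.cons_succ, Fin.cons_zero]
    rw [pow_succ', ← ih]
    exact lintegral_prod_mul hf.aemeasurable
      (Finset.measurable_fun_prod _ fun i _ => hf.comp (measurable_pi_apply i)).aemeasurable

theorem lintegral_pow_lintegral (ρ : Measure α) [SigmaFinite ρ] (P : Measure Ω) [SFinite P]
    {Y : α → Ω → ℝ≥0∞} (hY : Measurable (Function.uncurry Y)) (n : ℕ) :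
    ∫⁻ ω, (∫⁻ r, Y r ω ∂ρ) ^ n ∂P =
      ∫⁻ σ : Fin n → α, ∫⁻ ω, ∏ i, Y (σ i) ω ∂P ∂(Measure.pi fun _ => ρ) := by
  have hmeas : Measurable fun p : Ω × (Fin n → α) => ∏ i, Y (p.2 i) p.1 :=
    Finset.measurable_fun_prod _ fun i _ => by
      have h : Measurable fun p : Ω × (Fin n → α) => (p.2 i, p.1) := by fun_prop
      exact hY.comp h
  rw [← lintegral_lintegral_swap hmeas.aemeasurable]
  exact lintegral_congr fun ω =>
    (lintegral_fin_prod_eq_pow ρ (hY.comp measurable_prodMk_right) n).symm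

theorem lintegral_exp_eq_tsum (P : Measure Ω) {A : Ω → ℝ} (hA : Measurable A)
    (hA0 : ∀ ω, 0 ≤ A ω) :
    ∫⁻ ω, ENNReal.ofReal (Real.exp (A ω)) ∂P =
      ∑' n : ℕ, (∫⁻ ω, ENNReal.ofReal (A ω) ^ n ∂P) * (n.factorial : ℝ≥0∞)⁻¹ := by
  have hexp : ∀ ω, ENNReal.ofReal (Real.exp (A ω)) =
      ∑' n : ℕ, ENNReal.ofReal (A ω) ^ n * (n.factorial : ℝ≥0∞)⁻¹ := by
    intro ω
    rw [Real.exp_eq_exp_ℝ, NormedSpace.exp_eq_tsum_div, ENNReal.ofReal_tsum_of_nonneg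
      (fun n => div_nonneg (pow_nonneg (hA0 ω) n) n.factorial.cast_nonneg)
      (Real.summable_pow_div_factorial _)]
    refine tsum_congr fun n => ?_
    rw [ENNReal.ofReal_div_of_pos (by positivity), ENNReal.ofReal_pow (hA0 ω),
      ENNReal.ofReal_natCast, div_eq_mul_inv]
  simp_rw [hexp]
  rw [lintegral_tsum fun n => ((hA.ennreal_ofReal.pow_const n).mul_const _).aemeasurable]
  exact tsum_congr fun n => lintegral_mul_const _ (hA.ennreal_ofReal.pow_const n)

/-- The moments of `∫ Y dρ` are integrals of product moments of `Y`, and determine the exponential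
moment through the power series. -/
theorem lintegral_exp_integral_eq_of_product_moments (ρ : Measure α) [SigmaFinite ρ]
    {P : Measure Ω} [SFinite P] {Q : Measure Ω'} [SFinite Q] {Y : α → Ω → ℝ} {Z : α → Ω' → ℝ}
    (hY : Measurable (Function.uncurry Y)) (hZ : Measurable (Function.uncurry Z))
    (hY0 : ∀ r ω, 0 ≤ Y r ω) (hZ0 : ∀ r ω, 0 ≤ Z r ω)
    (hYint : ∀ ω, Integrable (Y · ω) ρ) (hZint : ∀ ω, Integrable (Z · ω) ρ)
    (h : ∀ (n : ℕ) (σ : Fin n → α), ∫⁻ ω, ∏ i, ENNReal.ofReal (Y (σ i) ω) ∂P =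
      ∫⁻ ω, ∏ i, ENNReal.ofReal (Z (σ i) ω) ∂Q) :
    ∫⁻ ω, ENNReal.ofReal (Real.exp (∫ r, Y r ω ∂ρ)) ∂P =
      ∫⁻ ω, ENNReal.ofReal (Real.exp (∫ r, Z r ω ∂ρ)) ∂Q := by
  rw [lintegral_exp_eq_tsum P hY.stronglyMeasurable.integral_prod_left.measurable
      fun ω => integral_nonneg (hY0 · ω),
    lintegral_exp_eq_tsum Q hZ.stronglyMeasurable.integral_prod_left.measurable
      fun ω => integral_nonneg (hZ0 · ω)]
  simp_rw [fun ω => ofReal_integral_eq_lintegral_ofReal (hYint ω) (ae_of_all _ (hY0 · ω)),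
    fun ω => ofReal_integral_eq_lintegral_ofReal (hZint ω) (ae_of_all _ (hZ0 · ω)),
    lintegral_pow_lintegral ρ P (Y := fun r ω => ENNReal.ofReal (Y r ω)) hY.ennreal_ofReal,
    lintegral_pow_lintegral ρ Q (Y := fun r ω => ENNReal.ofReal (Z r ω)) hZ.ennreal_ofReal, h]

end Moments

namespace MarkovProcess

variable {E Ω : Type*} [MeasurableSpace E] [MeasurableSpace Ω] (M : MarkovProcess E Ω)

instance : IsMarkovKernel M.law := M.isMarkovKernel_law

theorem measurable_at (t : ℝ≥0) : Measurable (M.X t) :=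
  M.measurable_X.comp measurable_prodMk_left

instance (t : ℝ≥0) : IsMarkovKernel (M.transition t) :=
  Kernel.IsMarkovKernel.map _ (M.measurable_at t)

instance (ν : Measure E) [IsProbabilityMeasure ν] : IsProbabilityMeasure (M.lawFrom ν) :=
  inferInstanceAs (IsProbabilityMeasure (ν.bind M.law))

theorem transition_apply (t : ℝ≥0) (x : E) : M.transition t x = (M.law x).map (M.X t) :=
  Kernel.map_apply _ (M.measurable_at t) x

theorem lintegral_transition (t : ℝ≥0) (x : E) {f : E → ℝ≥0∞} (hf : Measurable f) :
    ∫⁻ y, f y ∂M.transition t x = ∫⁻ ω, f (M.X t ω) ∂M.law x := by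
  rw [transition_apply, lintegral_map hf (M.measurable_at t)]

theorem lintegral_lawFrom (ν : Measure E) {f : Ω → ℝ≥0∞} (hf : Measurable f) :
    ∫⁻ ω, f ω ∂M.lawFrom ν = ∫⁻ x, ∫⁻ ω, f ω ∂M.law x ∂ν :=
  Measure.lintegral_bind M.law.measurable.aemeasurable hf.aemeasurable

/-- The σ-algebra `σ(X_r, r ≤ s)` of the natural filtration, spelled as in the Markov property. -/
abbrev past (s : ℝ≥0) : MeasurableSpace Ω :=
  ⨆ r : Set.Iic s, MeasurableSpace.comap (M.X r) inferInstance

theorem past_le (s : ℝ≥0) : M.past s ≤ ‹MeasurableSpace Ω› :=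
  iSup_le fun r => (M.measurable_at r).comap_le

theorem measurable_past {r s : ℝ≥0} (h : r ≤ s) : Measurable[M.past s] (M.X r) :=
  Measurable.mono (comap_measurable _)
    (le_iSup (fun r : Set.Iic s => MeasurableSpace.comap (M.X r) inferInstance) ⟨r, h⟩) le_rfl

theorem setLIntegral_markov (x : E) (s t : ℝ≥0) {B : Set Ω} (hB : MeasurableSet[M.past s] B)
    {f : E → ℝ≥0∞} (hf : Measurable f) :
    ∫⁻ ω in B, f (M.X (s + t) ω) ∂M.law x =
      ∫⁻ ω in B, ∫⁻ y, f y ∂M.transition t (M.X s ω) ∂M.law x := by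
  have key : ((M.law x).restrict B).map (M.X (s + t)) =
      (((M.law x).restrict B).map (M.X s)).bind (M.transition t) := by
    ext A hA
    rw [Measure.map_apply (M.measurable_at _) hA,
      Measure.restrict_apply (M.measurable_at _ hA), Measure.bind_apply hA
      (M.transition t).measurable.aemeasurable, lintegral_map
      ((M.transition t).measurable_coe hA) (M.measurable_at s), inter_comm,
      M.markov x s t B A hB hA]
    refine lintegral_congr fun ω => ?_
    rw [transition_apply, Measure.map_apply (M.measurable_at _) hA]
  rw [← lintegral_map hf (M.measurable_at _), key,
    Measure.lintegral_bind (M.transition t).measurable.aemeasurable hf.aemeasurable,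
    lintegral_map hf.lintegral_kernel (M.measurable_at s)]

theorem lintegral_mul_markov (x : E) (s t : ℝ≥0) {G : Ω → ℝ≥0∞} (hG : Measurable[M.past s] G)
    {f : E → ℝ≥0∞} (hf : Measurable f) :
    ∫⁻ ω, G ω * f (M.X (s + t) ω) ∂M.law x =
      ∫⁻ ω, G ω * ∫⁻ y, f y ∂M.transition t (M.X s ω) ∂M.law x := by
  have hG' : Measurable G := hG.mono (M.past_le s) le_rfl
  have hfX : Measurable fun ω => f (M.X (s + t) ω) := hf.comp (M.measurable_at _)
  have hPf : Measurable fun ω => ∫⁻ y, f y ∂M.transition t (M.X s ω) :=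
    hf.lintegral_kernel.comp (M.measurable_at s)
  have key : ((M.law x).withDensity fun ω => f (M.X (s + t) ω)).trim (M.past_le s) =
      ((M.law x).withDensity fun ω => ∫⁻ y, f y ∂M.transition t (M.X s ω)).trim
        (M.past_le s) := by
    refine @Measure.ext _ (M.past s) _ _ fun B hB => ?_
    rw [trim_measurableSet_eq _ hB, trim_measurableSet_eq _ hB,
      withDensity_apply _ (M.past_le s _ hB), withDensity_apply _ (M.past_le s _ hB),
      M.setLIntegral_markov x s t hB hf]
  simp_rw [mul_comm (G _)]
  calc ∫⁻ ω, f (M.X (s + t) ω) * G ω ∂M.law x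
      = ∫⁻ ω, G ω ∂((M.law x).withDensity fun ω => f (M.X (s + t) ω)) :=
        (lintegral_withDensity_eq_lintegral_mul _ hfX hG').symm
    _ = ∫⁻ ω, G ω ∂((M.law x).withDensity fun ω => ∫⁻ y, f y ∂M.transition t (M.X s ω)) := by
        rw [← lintegral_trim (M.past_le s) hG, key, lintegral_trim (M.past_le s) hG]
    _ = ∫⁻ ω, (∫⁻ y, f y ∂M.transition t (M.X s ω)) * G ω ∂M.law x :=
        lintegral_withDensity_eq_lintegral_mul _ hPf hG'

/-- By the Markov property at the last but one time `q`, the factor at the last time `r` can be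
replaced by its `P_{r - q}`-image at time `q`. -/
theorem exists_lintegral_prod_insert_eq {J : Finset ℝ≥0} (hJ : J.Nonempty) {r : ℝ≥0}
    (hr : ∀ i ∈ J, i < r) {f : ℝ≥0 → E → ℝ≥0∞} (hf : ∀ i, Measurable (f i)) :
    ∃ g : ℝ≥0 → E → ℝ≥0∞, (∀ i, Measurable (g i)) ∧ ∀ x s,
      ∫⁻ ω, ∏ i ∈ insert r J, f i (M.X (s + i) ω) ∂M.law x =
        ∫⁻ ω, ∏ i ∈ J, g i (M.X (s + i) ω) ∂M.law x := by
  set q := J.max' hJ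
  have hqr : q + (r - q) = r := add_tsub_cancel_of_le (hr q (J.max'_mem hJ)).le
  refine ⟨fun i y => f i y * if i = q then ∫⁻ z, f r z ∂M.transition (r - q) y else 1,
    fun i => (hf i).mul ?_, fun x s => ?_⟩
  · split_ifs
    exacts [(hf r).lintegral_kernel, measurable_const]
  have hG : Measurable[M.past (s + q)] fun ω => ∏ i ∈ J, f i (M.X (s + i) ω) :=
    Finset.measurable_fun_prod _ fun i hi =>
      (hf i).comp (M.measurable_past (add_le_add_right (J.le_max' i hi) s))
  have hmarkov := M.lintegral_mul_markov x (s + q) (r - q) hG (hf r)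
  rw [add_assoc, hqr] at hmarkov
  simp_rw [Finset.prod_insert fun h => lt_irrefl r (hr r h), mul_comm (f r _), hmarkov]
  refine lintegral_congr fun ω => ?_
  rw [Finset.prod_mul_distrib, Finset.prod_ite_eq_of_mem' _ _ _ (J.max'_mem hJ)]

theorem lintegral_finset_prod_shift (x : E) (s : ℝ≥0) (J : Finset ℝ≥0) :
    ∀ {f : ℝ≥0 → E → ℝ≥0∞}, (∀ i, Measurable (f i)) →
      ∫⁻ ω, ∏ i ∈ J, f i (M.X (s + i) ω) ∂M.law x =
        ∫⁻ y, ∫⁻ ω, ∏ i ∈ J, f i (M.X i ω) ∂M.law y ∂M.transition s x := by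
  induction J using Finset.induction_on_max with
  | empty => simp
  | insert r J hr ih =>
    intro f hf
    rcases J.eq_empty_or_nonempty with rfl | hJ
    · have hmarkov := M.setLIntegral_markov x s r MeasurableSet.univ (hf r)
      simp only [Measure.restrict_univ] at hmarkov
      simp_rw [insert_empty_eq, Finset.prod_singleton, hmarkov,
        ← M.lintegral_transition r _ (hf r)]
      rw [M.lintegral_transition s x (hf r).lintegral_kernel]
    · obtain ⟨g, hg, hfg⟩ := M.exists_lintegral_prod_insert_eq hJ hr hf
      have hfg0 := fun y => hfg y 0
      simp only [zero_add] at hfg0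
      simp_rw [hfg, ih hg, hfg0]

theorem lintegral_fin_prod_shift (x : E) (s : ℝ≥0) {f : E → ℝ≥0∞} (hf : Measurable f) {n : ℕ}
    (σ : Fin n → ℝ≥0) :
    ∫⁻ ω, ∏ i, f (M.X (s + σ i) ω) ∂M.law x =
      ∫⁻ ω, ∏ i, f (M.X (σ i) ω) ∂M.lawFrom (M.transition s x) := by
  classical
  have hprod : Measurable fun ω => ∏ i, f (M.X (σ i) ω) :=
    Finset.measurable_fun_prod _ fun i _ => hf.comp (M.measurable_at (σ i))
  rw [M.lintegral_lawFrom _ hprod]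
  simp_rw [fun ω => Finset.prod_comp (s := Finset.univ) (fun b => f (M.X (s + b) ω)) σ,
    fun ω => Finset.prod_comp (s := Finset.univ) (fun b => f (M.X b ω)) σ]
  exact M.lintegral_finset_prod_shift x s (Finset.univ.image σ)
    (f := fun b y => f y ^ (Finset.univ.filter fun a => σ a = b).card) fun i => hf.pow_const _

end MarkovProcess

section MeanSquare

variable {α β : Type*} [MeasurableSpace α] [MeasurableSpace β]

theorem integrable_of_abs_le {ρ : Measure α} [IsFiniteMeasure ρ] {f : α → ℝ} (hf : Measurable f)
    {C : ℝ} (hC : ∀ a, |f a| ≤ C) : Integrable f ρ :=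
  Integrable.of_bound hf.aestronglyMeasurable C (ae_of_all _ hC)

theorem memLp_of_abs_le {ρ : Measure α} [IsFiniteMeasure ρ] {f : α → ℝ} (hf : Measurable f)
    {C : ℝ} (hC : ∀ a, |f a| ≤ C) (p : ℝ≥0∞) : MemLp f p ρ :=
  MemLp.of_bound hf.aestronglyMeasurable C (ae_of_all _ hC)

theorem abs_integral_le_of_abs_le {ρ : Measure α} [IsProbabilityMeasure ρ] {f : α → ℝ} {C : ℝ}
    (hC : ∀ a, |f a| ≤ C) : |∫ a, f a ∂ρ| ≤ C := by
  simpa using norm_integral_le_of_norm_le_const (μ := ρ) (f := f) (ae_of_all _ hC)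

theorem eLpNorm_two_sq (ρ : Measure α) (f : α → ℝ) :
    eLpNorm f 2 ρ ^ 2 = ∫⁻ a, ‖f a‖ₑ ^ 2 ∂ρ := by
  simpa using eLpNorm_nnreal_pow_eq_lintegral (f := f) (μ := ρ) (p := 2) two_ne_zero

theorem eLpNorm_two_sq_eq_ofReal {ρ : Measure α} {f : α → ℝ} (hf : MemLp f 2 ρ) :
    eLpNorm f 2 ρ ^ 2 = ENNReal.ofReal (∫ a, f a ^ 2 ∂ρ) := by
  rw [eLpNorm_two_sq, ofReal_integral_eq_lintegral_ofReal hf.integrable_sq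
    (ae_of_all _ fun _ => sq_nonneg _)]
  refine lintegral_congr fun a => ?_
  rw [Real.enorm_eq_ofReal_abs, ← ENNReal.ofReal_pow (abs_nonneg _), sq_abs]

theorem enorm_integral_sq_le_lintegral {ρ : Measure α} [IsProbabilityMeasure ρ] {f : α → ℝ}
    (hf : AEStronglyMeasurable f ρ) : ‖∫ a, f a ∂ρ‖ₑ ^ 2 ≤ ∫⁻ a, ‖f a‖ₑ ^ 2 ∂ρ := by
  rw [← eLpNorm_two_sq]
  gcongr
  calc ‖∫ a, f a ∂ρ‖ₑ ≤ eLpNorm f 1 ρ := by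
        rw [eLpNorm_one_eq_lintegral_enorm]
        exact enorm_integral_le_lintegral_enorm _
    _ ≤ eLpNorm f 2 ρ := eLpNorm_le_eLpNorm_of_exponent_le one_le_two hf

theorem eLpNorm_two_integral_kernel_le (μ : Measure α) (κ : Kernel α β) [IsMarkovKernel κ]
    {f : β → ℝ} (hf : Measurable f) :
    eLpNorm (fun x => ∫ y, f y ∂κ x) 2 μ ≤ eLpNorm f 2 (μ.bind κ) := by
  refine (ENNReal.pow_le_pow_left_iff two_ne_zero).1 ?_
  rw [eLpNorm_two_sq, eLpNorm_two_sq, Measure.lintegral_bind κ.measurable.aemeasurable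
    (hf.enorm.pow_const 2).aemeasurable]
  exact lintegral_mono fun x => enorm_integral_sq_le_lintegral hf.aestronglyMeasurable

theorem eLpNorm_two_integral_le {ρ : Measure α} [IsProbabilityMeasure ρ] {μ : Measure β}
    [SFinite μ] {f : α → β → ℝ} (hf : Measurable (Function.uncurry f)) {δ : ℝ≥0∞}
    (hδ : ∀ᵐ s ∂ρ, eLpNorm (f s) 2 μ ≤ δ) : eLpNorm (fun x => ∫ s, f s x ∂ρ) 2 μ ≤ δ := by
  refine (ENNReal.pow_le_pow_left_iff two_ne_zero).1 ?_
  rw [eLpNorm_two_sq]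
  calc ∫⁻ x, ‖∫ s, f s x ∂ρ‖ₑ ^ 2 ∂μ ≤ ∫⁻ x, ∫⁻ s, ‖f s x‖ₑ ^ 2 ∂ρ ∂μ :=
        lintegral_mono fun x => enorm_integral_sq_le_lintegral
          (hf.comp measurable_prodMk_right).aestronglyMeasurable
    _ = ∫⁻ s, ∫⁻ x, ‖f s x‖ₑ ^ 2 ∂μ ∂ρ :=
        lintegral_lintegral_swap ((hf.enorm.pow_const 2).comp measurable_swap).aemeasurable
    _ ≤ ∫⁻ _, δ ^ 2 ∂ρ := by
        refine lintegral_mono_ae (hδ.mono fun s hs => ?_)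
        rw [← eLpNorm_two_sq]
        gcongr
    _ = δ ^ 2 := by simp

theorem tendsto_eLpNorm_two_average_zero {μ : Measure β} [SFinite μ] {D : ℝ → β → ℝ}
    (hD : Measurable (Function.uncurry D))
    (hlim : Tendsto (fun r => eLpNorm (D r) 2 μ) (𝓝[>] 0) (𝓝 0)) :
    Tendsto (fun h => eLpNorm (fun x => h⁻¹ * ∫ r in (0 : ℝ)..h, D r x) 2 μ) (𝓝[>] 0) (𝓝 0) := by
  rw [ENNReal.tendsto_nhds_zero] at hlim ⊢
  intro δ hδ
  obtain ⟨u, hu, hsub⟩ := mem_nhdsGT_iff_exists_Ioo_subset.1 (hlim δ hδ)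
  filter_upwards [Ioo_mem_nhdsGT hu] with h hh
  have hvol : volume (Ioc 0 h) ≠ 0 := by simp [hh.1]
  have := cond_isProbabilityMeasure_of_finite hvol measure_Ioc_lt_top.ne
  have haverage : (fun x => h⁻¹ * ∫ r in (0 : ℝ)..h, D r x) =
      fun x => ∫ r, D r x ∂volume[|Ioc 0 h] := by
    ext x
    rw [ProbabilityTheory.cond, integral_smul_measure, intervalIntegral.integral_of_le hh.1.le,
      Real.volume_Ioc, sub_zero, ENNReal.toReal_inv, ENNReal.toReal_ofReal hh.1.le, smul_eq_mul]
  rw [haverage]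
  refine eLpNorm_two_integral_le hD (Measure.ae_smul_measure ?_ _)
  filter_upwards [ae_restrict_mem measurableSet_Ioc] with r hr
  exact hsub ⟨hr.1, hr.2.trans_lt hh.2⟩

theorem tendsto_eLpNorm_two_zero_of_abs_le {ρ : Measure α} [IsProbabilityMeasure ρ]
    {F G : ℝ → α → ℝ} (c C : ℝ) (hG : ∀ h, Measurable (G h))
    (hFG : ∀ᶠ h in 𝓝[>] (0 : ℝ), ∀ a, |F h a| ≤ c * |G h a| + C * h)
    (hlim : Tendsto (fun h => eLpNorm (G h) 2 ρ) (𝓝[>] 0) (𝓝 0)) :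
    Tendsto (fun h => eLpNorm (F h) 2 ρ) (𝓝[>] 0) (𝓝 0) := by
  have hbound : Tendsto (fun h : ℝ => ‖c‖ₑ * eLpNorm (G h) 2 ρ + ‖C * h‖ₑ) (𝓝[>] 0) (𝓝 0) := by
    have hlinear : Tendsto (fun h : ℝ => ‖C * h‖ₑ) (𝓝[>] 0) (𝓝 0) := by
      have hcont : Continuous fun h : ℝ => ‖C * h‖ₑ := by fun_prop
      simpa using (hcont.tendsto 0).mono_left nhdsWithin_le_nhds
    simpa using (ENNReal.Tendsto.const_mul hlim (Or.inr enorm_ne_top)).add hlinear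
  refine tendsto_of_tendsto_of_tendsto_of_le_of_le' tendsto_const_nhds hbound
    (Eventually.of_forall fun _ => zero_le) ?_
  filter_upwards [hFG] with h hh
  calc eLpNorm (F h) 2 ρ ≤ eLpNorm ((fun a => c * |G h a|) + fun _ => C * h) 2 ρ :=
        eLpNorm_mono_real fun a => hh a
    _ ≤ eLpNorm (fun a => c * |G h a|) 2 ρ + eLpNorm (fun _ : α => C * h) 2 ρ :=
        eLpNorm_add_le ((hG h).abs.const_mul c).aestronglyMeasurable
          aestronglyMeasurable_const one_le_two
    _ = ‖c‖ₑ * eLpNorm (G h) 2 ρ + ‖C * h‖ₑ := by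
        rw [eLpNorm_const _ two_ne_zero (NeZero.ne ρ)]
        have hsmul := eLpNorm_const_smul c (fun a => |G h a|) 2 ρ
        have habs := eLpNorm_norm (G h) (p := 2) (μ := ρ)
        simp only [Real.norm_eq_abs] at habs
        simp only [habs] at hsmul
        rw [measure_univ, ENNReal.one_rpow, mul_one]
        exact congrArg (· + ‖C * h‖ₑ) hsmul

theorem abs_exp_sub_exp_le {a b c : ℝ} (ha : a ≤ c) (hb : b ≤ c) :
    |Real.exp a - Real.exp b| ≤ Real.exp c * |a - b| := by
  wlog h : b ≤ a generalizing a b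
  · rw [abs_sub_comm, abs_sub_comm a b]
    exact this hb ha (le_of_not_ge h)
  rw [abs_of_nonneg (sub_nonneg.2 (Real.exp_le_exp.2 h)), abs_of_nonneg (sub_nonneg.2 h)]
  calc Real.exp a - Real.exp b = Real.exp a * (1 - Real.exp (b - a)) := by
        rw [mul_sub, ← Real.exp_add, mul_one, add_sub_cancel]
    _ ≤ Real.exp a * (a - b) := by
        exact mul_le_mul_of_nonneg_left (by linarith [Real.add_one_le_exp (b - a)])
          (Real.exp_nonneg a)
    _ ≤ Real.exp c * (a - b) := by gcongr

theorem abs_inv_mul_exp_sub_one_sub_le {h j K w : ℝ} (hh : 0 < h) (hj : |j| ≤ K * h)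
    (hKh : K * h ≤ 1) : |h⁻¹ * (Real.exp j - 1) - w| ≤ |h⁻¹ * j - w| + K ^ 2 * h := by
  have hsecond : |h⁻¹ * (Real.exp j - 1 - j)| ≤ K ^ 2 * h := by
    rw [abs_mul, abs_of_pos (inv_pos.2 hh), inv_mul_le_iff₀ hh]
    calc |Real.exp j - 1 - j| ≤ |j| ^ 2 := by
          rw [sq_abs]
          exact Real.abs_exp_sub_one_sub_id_le (hj.trans hKh)
      _ ≤ (K * h) ^ 2 := by gcongr
      _ = h * (K ^ 2 * h) := by ring
  calc |h⁻¹ * (Real.exp j - 1) - w| = |(h⁻¹ * j - w) + h⁻¹ * (Real.exp j - 1 - j)| := by ring_nf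
    _ ≤ |h⁻¹ * j - w| + K ^ 2 * h := (abs_add_le _ _).trans (by gcongr)

theorem abs_inv_mul_exp_add_sub_mul_exp_le {h i i' j K w c : ℝ} (hh : 0 < h) (hi : i ≤ c)
    (hi' : i' ≤ c) (hii' : |i - i'| ≤ 2 * K * h) (hj : |j| ≤ K * h) (hw : |w| ≤ K)
    (hKh : K * h ≤ 1) :
    |h⁻¹ * (Real.exp (i + j) - Real.exp i) - w * Real.exp i'| ≤
      Real.exp c * |h⁻¹ * j - w| + 3 * Real.exp c * K ^ 2 * h := by
  have hK : 0 ≤ K := (abs_nonneg w).trans hw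
  calc |h⁻¹ * (Real.exp (i + j) - Real.exp i) - w * Real.exp i'|
      = |Real.exp i * (h⁻¹ * (Real.exp j - 1) - w) + w * (Real.exp i - Real.exp i')| := by
        rw [Real.exp_add]
        ring_nf
    _ ≤ Real.exp i * |h⁻¹ * (Real.exp j - 1) - w| + |w| * |Real.exp i - Real.exp i'| := by
        refine (abs_add_le _ _).trans_eq ?_
        rw [abs_mul, abs_mul, Real.abs_exp]
    _ ≤ Real.exp c * (|h⁻¹ * j - w| + K ^ 2 * h) + K * (Real.exp c * (2 * K * h)) := by
        gcongr
        · exact abs_inv_mul_exp_sub_one_sub_le hh hj hKh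
        · exact (abs_exp_sub_exp_le hi hi').trans (by gcongr)
    _ = Real.exp c * |h⁻¹ * j - w| + 3 * Real.exp c * K ^ 2 * h := by ring

end MeanSquare

namespace MarkovProcess

variable {E Ω : Type*} [MeasurableSpace E] [MeasurableSpace Ω] (M : MarkovProcess E Ω)

theorem integral_lawFrom {ν : Measure E} {f : Ω → ℝ} (hf : Integrable f (M.lawFrom ν)) :
    ∫ ω, f ω ∂M.lawFrom ν = ∫ x, ∫ ω, f ω ∂M.law x ∂ν := by
  rw [lawFrom, Measure.comp_eq_comp_const_apply] at hf ⊢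
  rw [Kernel.integral_comp hf, Kernel.const_apply]

theorem measurable_semigroup (t : ℝ≥0) {f : E → ℝ} (hf : Measurable f) :
    Measurable (M.semigroup t f) :=
  (hf.stronglyMeasurable.integral_kernel (κ := M.transition t)).measurable

theorem map_lawFrom_prodMk (μ : Measure E) [IsProbabilityMeasure μ] (s t : ℝ≥0) :
    (M.lawFrom μ).map (fun ω => (M.X s ω, M.X (s + t) ω)) =
      (μ.bind (M.transition s)) ⊗ₘ M.transition t := by
  have hpair : Measurable fun ω => (M.X s ω, M.X (s + t) ω) :=
    (M.measurable_at s).prodMk (M.measurable_at _)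
  have := Measure.isProbabilityMeasure_map (μ := M.lawFrom μ) hpair.aemeasurable
  refine Measure.ext_prod fun {A B} hA hB => ?_
  have hpast : MeasurableSet[M.past s] (M.X s ⁻¹' A) := M.measurable_past le_rfl hA
  have hindicator : Measurable (A.indicator fun y => M.transition t y B) :=
    ((M.transition t).measurable_coe hB).indicator hA
  rw [Measure.map_apply hpair (hA.prod hB), Measure.compProd_apply_prod hA hB,
    ← lintegral_indicator hA, Measure.lintegral_bind (M.transition s).measurable.aemeasurable
    hindicator.aemeasurable, lawFrom, Measure.bind_apply (hpair (hA.prod hB))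
    M.law.measurable.aemeasurable]
  refine lintegral_congr fun x => ?_
  rw [mk_preimage_prod, M.markov x s t _ B hpast hB, M.lintegral_transition s x hindicator,
    ← lintegral_indicator (M.measurable_at s hA)]
  refine lintegral_congr fun ω => ?_
  simp only [indicator, transition_apply, Measure.map_apply (M.measurable_at t) hB]
  rfl

theorem abs_semigroup_le (t : ℝ≥0) {f : E → ℝ} {K : ℝ} (hK : ∀ x, |f x| ≤ K) (x : E) :
    |M.semigroup t f x| ≤ K :=
  abs_integral_le_of_abs_le hK

theorem integral_semigroup {μ : Measure E} (hinv : M.IsInvariant μ) (t : ℝ≥0)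
    {f : E → ℝ} (hf : Integrable f μ) : ∫ x, M.semigroup t f x ∂μ = ∫ x, f x ∂μ := by
  have hbind : μ.bind (M.transition t) = μ := hinv t
  conv_rhs => rw [← hbind]
  rw [← hbind, Measure.comp_eq_comp_const_apply] at hf
  rw [Measure.comp_eq_comp_const_apply, Kernel.integral_comp hf, Kernel.const_apply]
  rfl

theorem integral_sq_sub_transition (t : ℝ≥0) {f : E → ℝ} (hf : Measurable f) {K : ℝ}
    (hK : ∀ x, |f x| ≤ K) (x : E) :
    ∫ y, (f y - f x) ^ 2 ∂M.transition t x =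
      M.semigroup t (fun y => f y ^ 2) x - f x ^ 2 - 2 * (f x * (M.semigroup t f x - f x)) := by
  have hlinear : Integrable (fun y => 2 * f x * f y) (M.transition t x) :=
    (integrable_of_abs_le hf hK).const_mul _
  have hsquare : Integrable (fun y => f y ^ 2) (M.transition t x) :=
    (memLp_of_abs_le hf hK 2).integrable_sq
  have hexpand : ∀ y, (f y - f x) ^ 2 = f y ^ 2 - 2 * f x * f y + f x ^ 2 := fun y => by ring
  simp_rw [hexpand]
  rw [integral_add (by exact hsquare.sub hlinear) (integrable_const _),
    integral_sub hsquare hlinear, integral_const_mul]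
  simp only [integral_const, probReal_univ, one_smul, semigroup]
  ring

/-- The squares `f(X_{s+t})²` and `f(X_s)²` have the same expectation and cancel. -/
theorem integral_sq_increment {μ : Measure E} [IsProbabilityMeasure μ]
    (hinv : M.IsInvariant μ) {f : E → ℝ} (hf : Measurable f) {K : ℝ} (hK : ∀ x, |f x| ≤ K)
    (s t : ℝ≥0) :
    ∫ ω, (f (M.X (s + t) ω) - f (M.X s ω)) ^ 2 ∂M.lawFrom μ =
      -2 * ∫ x, f x * (M.semigroup t f x - f x) ∂μ := by
  have hpair : Measurable fun ω => (M.X s ω, M.X (s + t) ω) :=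
    (M.measurable_at s).prodMk (M.measurable_at _)
  have hjump : Measurable fun p : E × E => f p.2 - f p.1 := by fun_prop
  have hjumpSq : Integrable (fun p : E × E => (f p.2 - f p.1) ^ 2) (μ ⊗ₘ M.transition t) :=
    (memLp_of_abs_le hjump (fun p => (abs_sub _ _).trans (add_le_add (hK _) (hK _)))
      2).integrable_sq
  have hsq : Integrable (fun x => f x ^ 2) μ := (memLp_of_abs_le hf hK 2).integrable_sq
  have hPsq : Integrable (M.semigroup t fun y => f y ^ 2) μ :=
    integrable_of_abs_le (M.measurable_semigroup t (hf.pow_const 2)) <|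
      M.abs_semigroup_le t fun x => (abs_pow (f x) 2).le.trans
        (pow_le_pow_left₀ (abs_nonneg _) (hK x) 2)
  have hcross : Integrable (fun x => 2 * (f x * (M.semigroup t f x - f x))) μ :=
    (((memLp_of_abs_le hf hK 2).integrable_mul
      ((memLp_of_abs_le (M.measurable_semigroup t hf) (M.abs_semigroup_le t hK) 2).sub
        (memLp_of_abs_le hf hK 2)))).const_mul 2
  have hmarginal : μ.bind (M.transition s) = μ := hinv s
  calc ∫ ω, (f (M.X (s + t) ω) - f (M.X s ω)) ^ 2 ∂M.lawFrom μ
      = ∫ p : E × E, (f p.2 - f p.1) ^ 2 ∂(μ ⊗ₘ M.transition t) := by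
        rw [← hmarginal, ← M.map_lawFrom_prodMk, hmarginal, integral_map hpair.aemeasurable
          (hjump.pow_const 2).aestronglyMeasurable]
    _ = ∫ x, (M.semigroup t (fun y => f y ^ 2) x - f x ^ 2
          - 2 * (f x * (M.semigroup t f x - f x))) ∂μ := by
        rw [Measure.integral_compProd hjumpSq]
        exact integral_congr_ae (ae_of_all _ (M.integral_sq_sub_transition t hf hK))
    _ = -2 * ∫ x, f x * (M.semigroup t f x - f x) ∂μ := by
        rw [integral_sub (by exact hPsq.sub hsq) hcross, integral_sub hPsq hsq,
          M.integral_semigroup hinv t hsq, integral_const_mul]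
        ring

theorem eLpNorm_two_increment_sq_le {μ : Measure E} [IsProbabilityMeasure μ]
    (hinv : M.IsInvariant μ) {f : E → ℝ} (hf : Measurable f) {K : ℝ} (hK : ∀ x, |f x| ≤ K)
    (s t : ℝ≥0) :
    eLpNorm (fun ω => f (M.X (s + t) ω) - f (M.X s ω)) 2 (M.lawFrom μ) ^ 2 ≤
      ENNReal.ofReal (2 * K) * eLpNorm (fun x => M.semigroup t f x - f x) 2 μ := by
  have hincrement : MemLp (fun ω => f (M.X (s + t) ω) - f (M.X s ω)) 2 (M.lawFrom μ) :=
    memLp_of_abs_le ((hf.comp (M.measurable_at _)).sub (hf.comp (M.measurable_at s)))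
      (fun ω => (abs_sub _ _).trans (add_le_add (hK _) (hK _))) 2
  have hdiff : Measurable fun x => M.semigroup t f x - f x := (M.measurable_semigroup t hf).sub hf
  rw [eLpNorm_two_sq_eq_ofReal hincrement, M.integral_sq_increment hinv hf hK,
    ← integral_const_mul]
  calc ENNReal.ofReal (∫ x, -2 * (f x * (M.semigroup t f x - f x)) ∂μ)
      ≤ ∫⁻ x, ‖-2 * (f x * (M.semigroup t f x - f x))‖ₑ ∂μ :=
        (Real.ofReal_le_enorm _).trans (enorm_integral_le_lintegral_enorm _)
    _ ≤ ∫⁻ x, ENNReal.ofReal (2 * K) * ‖M.semigroup t f x - f x‖ₑ ∂μ := by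
        refine lintegral_mono fun x => ?_
        rw [← mul_assoc, enorm_mul, Real.enorm_eq_ofReal_abs (-2 * f x), abs_mul, abs_neg,
          abs_two]
        gcongr
        exact hK x
    _ = ENNReal.ofReal (2 * K) * eLpNorm (fun x => M.semigroup t f x - f x) 1 μ := by
        rw [lintegral_const_mul _ hdiff.enorm, eLpNorm_one_eq_lintegral_enorm]
    _ ≤ ENNReal.ofReal (2 * K) * eLpNorm (fun x => M.semigroup t f x - f x) 2 μ := by
        gcongr
        exact eLpNorm_le_eLpNorm_of_exponent_le one_le_two hdiff.aestronglyMeasurable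

end MarkovProcess

theorem tendsto_toNNReal_nhdsGT_zero : Tendsto Real.toNNReal (𝓝[>] 0) (𝓝[>] 0) := by
  refine tendsto_nhdsWithin_iff.2 ⟨?_, ?_⟩
  · simpa using (continuous_real_toNNReal.tendsto 0).mono_left nhdsWithin_le_nhds
  · filter_upwards [self_mem_nhdsWithin] with r hr using Real.toNNReal_pos.2 hr

theorem tendsto_nhdsGT_zero_of_toNNReal {α : Type*} {l : Filter α} {f : ℝ≥0 → α} {g : ℝ → α}
    (hfg : ∀ t : ℝ≥0, f t = g t) (hg : Tendsto g (𝓝[>] 0) l) : Tendsto f (𝓝[>] 0) l := by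
  have hcoe : Tendsto ((↑) : ℝ≥0 → ℝ) (𝓝[>] 0) (𝓝[>] 0) := by
    refine tendsto_nhdsWithin_iff.2 ⟨?_, ?_⟩
    · simpa using (NNReal.continuous_coe.tendsto 0).mono_left nhdsWithin_le_nhds
    · filter_upwards [self_mem_nhdsWithin] with r hr using NNReal.coe_pos.2 hr
  simpa only [Function.comp_def, ← hfg] using hg.comp hcoe

namespace MarkovProcess

variable {E Ω : Type*} [MeasurableSpace E] [MeasurableSpace Ω] (M : MarkovProcess E Ω)

/-- The additive functional `∫_a^b W(X_r) dr`, with real times. -/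
def pathIntegral (W : E → ℝ) (a b : ℝ) (ω : Ω) : ℝ := ∫ r in a..b, W (M.X r.toNNReal ω)

/-- The Feynman–Kac operator `T_t g(x) = 𝔼_x[exp(∫_0^t W(X_r) dr) g(X_t)]`. -/
def feynmanKac (W : E → ℝ) (t : ℝ) (g : E → ℝ) (x : E) : ℝ :=
  ∫ ω, Real.exp (M.pathIntegral W 0 t ω) * g (M.X t.toNNReal ω) ∂M.law x

theorem measurable_uncurry_shift {W : E → ℝ} (hW : Measurable W) (s : ℝ≥0) :
    Measurable (Function.uncurry fun (r : ℝ) ω => W (M.X (s + r.toNNReal) ω)) :=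
  hW.comp (M.measurable_X.comp
    (by fun_prop : Measurable fun p : ℝ × Ω => (s + p.1.toNNReal, p.2)))

theorem measurable_pathIntegral {W : E → ℝ} (hW : Measurable W) (a b : ℝ) :
    Measurable (M.pathIntegral W a b) := by
  have hmeas := (M.measurable_uncurry_shift hW 0).stronglyMeasurable
  simp only [zero_add] at hmeas
  exact (hmeas.integral_prod_left.sub hmeas.integral_prod_left).measurable

theorem integral_shift_eq_pathIntegral (W : E → ℝ) {s t : ℝ} (hs : 0 ≤ s) (ht : 0 ≤ t) (ω : Ω) :
    ∫ r in (0 : ℝ)..t, W (M.X (s.toNNReal + r.toNNReal) ω) = M.pathIntegral W s (s + t) ω := by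
  have hshift := intervalIntegral.integral_comp_add_left (a := 0) (b := t)
    (fun r : ℝ => W (M.X r.toNNReal ω)) s
  rw [add_zero] at hshift
  rw [pathIntegral, ← hshift]
  refine intervalIntegral.integral_congr fun r hr => ?_
  rw [uIcc_of_le ht] at hr
  simp only [Real.toNNReal_add hs hr.1]

section Bounded

variable {W : E → ℝ} {K : ℝ}

theorem intervalIntegrable_shift (hW : Measurable W) (hK : ∀ x, |W x| ≤ K) (s : ℝ≥0) (a b : ℝ)
    (ω : Ω) : IntervalIntegrable (fun r : ℝ => W (M.X (s + r.toNNReal) ω)) volume a b :=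
  have hmeas := (M.measurable_uncurry_shift hW s).comp (measurable_prodMk_right (y := ω))
  ⟨integrable_of_abs_le hmeas fun _ => hK _, integrable_of_abs_le hmeas fun _ => hK _⟩

theorem intervalIntegrable_comp_X (hW : Measurable W) (hK : ∀ x, |W x| ≤ K) (a b : ℝ) (ω : Ω) :
    IntervalIntegrable (fun r : ℝ => W (M.X r.toNNReal ω)) volume a b := by
  simpa only [zero_add] using M.intervalIntegrable_shift hW hK 0 a b ω

theorem abs_pathIntegral_le (hK : ∀ x, |W x| ≤ K) (a b : ℝ) (ω : Ω) :
    |M.pathIntegral W a b ω| ≤ K * |b - a| := by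
  rw [pathIntegral, ← Real.norm_eq_abs]
  exact intervalIntegral.norm_integral_le_of_norm_le_const fun _ _ => hK _

theorem pathIntegral_add_adjacent (hW : Measurable W) (hK : ∀ x, |W x| ≤ K) (a b c : ℝ) (ω : Ω) :
    M.pathIntegral W a b ω + M.pathIntegral W b c ω = M.pathIntegral W a c ω :=
  intervalIntegral.integral_add_adjacent_intervals
    (M.intervalIntegrable_comp_X hW hK a b ω) (M.intervalIntegrable_comp_X hW hK b c ω)

theorem pathIntegral_le (hK : ∀ x, |W x| ≤ K) {a b : ℝ} (hab : a ≤ b) (ω : Ω) :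
    M.pathIntegral W a b ω ≤ K * (b - a) := by
  rw [← abs_of_nonneg (sub_nonneg.2 hab)]
  exact (le_abs_self _).trans (M.abs_pathIntegral_le hK a b ω)

theorem integrable_exp_pathIntegral (ρ : Measure Ω) [IsFiniteMeasure ρ] (hW : Measurable W)
    (hK : ∀ x, |W x| ≤ K) {a b : ℝ} (hab : a ≤ b) :
    Integrable (fun ω => Real.exp (M.pathIntegral W a b ω)) ρ :=
  integrable_of_abs_le (M.measurable_pathIntegral hW a b).exp fun ω =>
    (Real.abs_exp _).trans_le (Real.exp_le_exp.2 (M.pathIntegral_le hK hab ω))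

theorem measurable_feynmanKac (hW : Measurable W) (t : ℝ) {g : E → ℝ} (hg : Measurable g) :
    Measurable (M.feynmanKac W t g) :=
  ((((M.measurable_pathIntegral hW 0 t).exp).mul
    (hg.comp (M.measurable_at _))).stronglyMeasurable.integral_kernel (κ := M.law)).measurable

theorem abs_feynmanKac_le (hK : ∀ x, |W x| ≤ K) (t : ℝ) {g : E → ℝ} {C : ℝ}
    (hC : ∀ x, |g x| ≤ C) (x : E) : |M.feynmanKac W t g x| ≤ Real.exp (K * |t|) * C := by
  refine abs_integral_le_of_abs_le fun ω => ?_
  rw [abs_mul, Real.abs_exp]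
  gcongr
  · simpa using (le_abs_self _).trans (M.abs_pathIntegral_le hK 0 t ω)
  · exact hC _

variable {μ : Measure E} [IsProbabilityMeasure μ]

theorem tendsto_eLpNorm_two_increment (hinv : M.IsInvariant μ) (hcont : M.IsStronglyContinuous μ)
    (hW : Measurable W) (hK : ∀ x, |W x| ≤ K) (s : ℝ≥0) :
    Tendsto (fun r : ℝ => eLpNorm (fun ω => W (M.X (s + r.toNNReal) ω) - W (M.X s ω)) 2
      (M.lawFrom μ)) (𝓝[>] 0) (𝓝 0) := by
  have hsemigroup := (hcont W (memLp_of_abs_le hW hK 2)).comp tendsto_toNNReal_nhdsGT_zero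
  have hbound := ENNReal.Tendsto.const_mul (a := ENNReal.ofReal (2 * K)) hsemigroup
    (Or.inr ENNReal.ofReal_ne_top)
  rw [mul_zero] at hbound
  have hsq := tendsto_of_tendsto_of_tendsto_of_le_of_le tendsto_const_nhds hbound
    (fun _ => zero_le) fun r => M.eLpNorm_two_increment_sq_le hinv hW hK s r.toNNReal
  have hroot := ((ENNReal.continuous_rpow_const (y := (2 : ℝ)⁻¹)).tendsto 0).comp hsq
  rw [ENNReal.zero_rpow_of_pos (by norm_num)] at hroot
  refine hroot.congr fun r => ?_
  simpa using ENNReal.pow_rpow_inv_natCast two_ne_zero _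

theorem tendsto_eLpNorm_two_pathIntegral (hinv : M.IsInvariant μ)
    (hcont : M.IsStronglyContinuous μ) (hW : Measurable W) (hK : ∀ x, |W x| ≤ K) {s : ℝ}
    (hs : 0 ≤ s) :
    Tendsto (fun h : ℝ => eLpNorm (fun ω => h⁻¹ * M.pathIntegral W s (s + h) ω -
      W (M.X s.toNNReal ω)) 2 (M.lawFrom μ)) (𝓝[>] 0) (𝓝 0) := by
  have hD : Measurable (Function.uncurry fun (r : ℝ) ω =>
      W (M.X (s.toNNReal + r.toNNReal) ω) - W (M.X s.toNNReal ω)) :=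
    (M.measurable_uncurry_shift hW _).sub (hW.comp ((M.measurable_at _).comp measurable_snd))
  refine (tendsto_eLpNorm_two_average_zero hD
    (M.tendsto_eLpNorm_two_increment hinv hcont hW hK s.toNNReal)).congr' ?_
  filter_upwards [self_mem_nhdsWithin] with h (hh : 0 < h)
  congr 1
  ext ω
  rw [intervalIntegral.integral_sub (M.intervalIntegrable_shift hW hK _ _ _ ω)
    intervalIntegrable_const, M.integral_shift_eq_pathIntegral W hs hh.le,
    intervalIntegral.integral_const, sub_zero, smul_eq_mul, mul_sub, inv_mul_cancel_left₀ hh.ne']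

theorem lintegral_exp_pathIntegral_shift_of_nonneg (hW : Measurable W) (hW0 : ∀ x, 0 ≤ W x)
    (hK : ∀ x, |W x| ≤ K) {s t : ℝ} (hs : 0 ≤ s) (ht : 0 ≤ t) (x : E) :
    ∫⁻ ω, ENNReal.ofReal (Real.exp (M.pathIntegral W s (s + t) ω)) ∂M.law x =
      ∫⁻ ω, ENNReal.ofReal (Real.exp (M.pathIntegral W 0 t ω))
        ∂M.lawFrom (M.transition s.toNNReal x) := by
  have hproduct := lintegral_exp_integral_eq_of_product_moments (volume.restrict (Ioc 0 t))
    (P := M.law x) (Q := M.lawFrom (M.transition s.toNNReal x))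
    (M.measurable_uncurry_shift hW s.toNNReal) (M.measurable_uncurry_shift hW 0)
    (fun _ _ => hW0 _) (fun _ _ => hW0 _)
    (fun ω => (M.intervalIntegrable_shift hW hK _ 0 t ω).1)
    (fun ω => (M.intervalIntegrable_shift hW hK _ 0 t ω).1)
    fun n σ => by
      simpa only [zero_add] using
        M.lintegral_fin_prod_shift x s.toNNReal hW.ennreal_ofReal fun i => (σ i).toNNReal
  simp only [zero_add, ← intervalIntegral.integral_of_le ht,
    M.integral_shift_eq_pathIntegral W hs ht] at hproduct
  exact hproduct

theorem pathIntegral_add_const (hW : Measurable W) (hK : ∀ x, |W x| ≤ K) (c a b : ℝ) (ω : Ω) :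
    M.pathIntegral (fun x => W x + c) a b ω = M.pathIntegral W a b ω + (b - a) * c := by
  rw [pathIntegral, intervalIntegral.integral_add (M.intervalIntegrable_comp_X hW hK a b ω)
    intervalIntegrable_const, intervalIntegral.integral_const, smul_eq_mul,
    pathIntegral]

theorem lintegral_exp_pathIntegral_shift (hW : Measurable W) (hK : ∀ x, |W x| ≤ K) {s t : ℝ}
    (hs : 0 ≤ s) (ht : 0 ≤ t) (x : E) :
    ∫⁻ ω, ENNReal.ofReal (Real.exp (M.pathIntegral W s (s + t) ω)) ∂M.law x =
      ∫⁻ ω, ENNReal.ofReal (Real.exp (M.pathIntegral W 0 t ω))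
        ∂M.lawFrom (M.transition s.toNNReal x) := by
  have hshifted := M.lintegral_exp_pathIntegral_shift_of_nonneg (W := fun x => W x + K)
    (hW.add_const K) (fun y => by linarith [neg_le_of_abs_le (hK y)])
    (fun y => (abs_add_le _ _).trans (add_le_add_left (hK y) |K|)) hs ht x
  simp_rw [M.pathIntegral_add_const hW hK, add_sub_cancel_left, sub_zero, Real.exp_add,
    ENNReal.ofReal_mul (Real.exp_nonneg _)] at hshifted
  rw [lintegral_mul_const _ (M.measurable_pathIntegral hW s (s + t)).exp.ennreal_ofReal,
    lintegral_mul_const _ (M.measurable_pathIntegral hW 0 t).exp.ennreal_ofReal] at hshifted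
  exact (ENNReal.mul_left_inj (ENNReal.ofReal_pos.2 (Real.exp_pos _)).ne'
    ENNReal.ofReal_ne_top).1 hshifted

theorem semigroup_feynmanKac_one (hW : Measurable W) (hK : ∀ x, |W x| ≤ K) {s t : ℝ}
    (hs : 0 ≤ s) (ht : 0 ≤ t) (x : E) :
    M.semigroup s.toNNReal (M.feynmanKac W t 1) x =
      ∫ ω, Real.exp (M.pathIntegral W s (s + t) ω) ∂M.law x := by
  have hexp := (M.measurable_pathIntegral hW 0 t).exp
  simp only [semigroup, feynmanKac, Pi.one_apply, mul_one]
  rw [← M.integral_lawFrom (M.integrable_exp_pathIntegral _ hW hK ht),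
    integral_eq_lintegral_of_nonneg_ae
      (ae_of_all _ fun ω => Real.exp_nonneg _) hexp.aestronglyMeasurable,
    integral_eq_lintegral_of_nonneg_ae (ae_of_all _ fun ω => Real.exp_nonneg _)
      (M.measurable_pathIntegral hW s (s + t)).exp.aestronglyMeasurable,
    M.lintegral_exp_pathIntegral_shift hW hK hs ht]

end Bounded

end MarkovProcess

theorem eventually_mul_le_one (K : ℝ) : ∀ᶠ h in 𝓝[>] (0 : ℝ), K * h ≤ 1 := by
  have hlim : Tendsto (fun h : ℝ => K * h) (𝓝 0) (𝓝 0) :=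
    Continuous.tendsto' (by fun_prop) 0 0 (mul_zero K)
  exact (hlim.mono_left nhdsWithin_le_nhds).eventually_le_const one_pos

theorem integral_mul_sub_sub {α : Type*} [MeasurableSpace α] {ρ : Measure α} {f g k : α → ℝ}
    (c : ℝ) (hf : Integrable f ρ) (hg : Integrable g ρ) (hk : Integrable k ρ) :
    ∫ a, (c * (f a - g a) - k a) ∂ρ = c * (∫ a, f a ∂ρ - ∫ a, g a ∂ρ) - ∫ a, k a ∂ρ := by
  rw [integral_sub (by exact (hf.sub hg).const_mul c) hk, integral_const_mul, integral_sub hf hg]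

namespace MarkovProcess

variable {E Ω : Type*} [MeasurableSpace E] [MeasurableSpace Ω] (M : MarkovProcess E Ω)
  {W : E → ℝ} {K : ℝ} {μ : Measure E}

theorem tendsto_eLpNorm_two_integral_law {D : ℝ → Ω → ℝ} {D' : ℝ → E → ℝ}
    (hD : ∀ h, Measurable (D h)) (hD' : ∀ᶠ h in 𝓝[>] 0, ∀ x, D' h x = ∫ ω, D h ω ∂M.law x)
    (hlim : Tendsto (fun h => eLpNorm (D h) 2 (M.lawFrom μ)) (𝓝[>] (0 : ℝ)) (𝓝 0)) :
    Tendsto (fun h => eLpNorm (D' h) 2 μ) (𝓝[>] 0) (𝓝 0) := by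
  refine tendsto_of_tendsto_of_tendsto_of_le_of_le' tendsto_const_nhds hlim
    (Eventually.of_forall fun _ => zero_le) ?_
  filter_upwards [hD'] with h hh
  rw [funext hh]
  exact eLpNorm_two_integral_kernel_le μ M.law (hD h)

theorem feynmanKac_one (t : ℝ) (x : E) :
    M.feynmanKac W t 1 x = ∫ ω, Real.exp (M.pathIntegral W 0 t ω) ∂M.law x := by
  simp only [feynmanKac, Pi.one_apply, mul_one]

variable [IsProbabilityMeasure μ]

theorem tendsto_eLpNorm_two_feynmanKac_slope (hinv : M.IsInvariant μ)
    (hcont : M.IsStronglyContinuous μ) (hW : Measurable W) (hK : ∀ x, |W x| ≤ K) {t : ℝ}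
    (ht : 0 ≤ t) :
    Tendsto (fun h : ℝ => eLpNorm (fun x => h⁻¹ * (M.feynmanKac W (t + h) 1 x -
      M.feynmanKac W t 1 x) - M.feynmanKac W t W x) 2 μ) (𝓝[>] 0) (𝓝 0) := by
  have hWX : Measurable fun ω => W (M.X t.toNNReal ω) := hW.comp (M.measurable_at _)
  have hI := M.measurable_pathIntegral hW
  refine M.tendsto_eLpNorm_two_integral_law
    (D := fun h ω => h⁻¹ * (Real.exp (M.pathIntegral W 0 (t + h) ω) -
      Real.exp (M.pathIntegral W 0 t ω)) -
        W (M.X t.toNNReal ω) * Real.exp (M.pathIntegral W 0 t ω))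
    (fun h => (((hI 0 _).exp.sub (hI 0 t).exp).const_mul _).sub (hWX.mul (hI 0 t).exp)) ?_ ?_
  · filter_upwards [self_mem_nhdsWithin] with h (hh : 0 < h) x
    simp_rw [M.feynmanKac_one, feynmanKac, mul_comm _ (W (M.X t.toNNReal _))]
    exact (integral_mul_sub_sub h⁻¹ (M.integrable_exp_pathIntegral _ hW hK (by positivity))
      (M.integrable_exp_pathIntegral _ hW hK ht)
      ((M.integrable_exp_pathIntegral _ hW hK ht).bdd_mul hWX.aestronglyMeasurable
        (ae_of_all _ fun ω => hK _))).symm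
  · refine tendsto_eLpNorm_two_zero_of_abs_le (Real.exp (K * t)) (3 * Real.exp (K * t) * K ^ 2)
      (fun h => ((hI t (t + h)).const_mul _).sub hWX) ?_
      (M.tendsto_eLpNorm_two_pathIntegral hinv hcont hW hK ht)
    filter_upwards [self_mem_nhdsWithin, eventually_mul_le_one K] with h (hh : 0 < h) hKh ω
    have hsmall : |M.pathIntegral W t (t + h) ω| ≤ K * h := by
      simpa [abs_of_pos hh] using M.abs_pathIntegral_le hK t (t + h) ω
    have hi : M.pathIntegral W 0 t ω ≤ K * t := by simpa using M.pathIntegral_le hK ht ω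
    have hK0 : 0 ≤ K := (abs_nonneg _).trans (hK (M.X 0 ω))
    rw [← M.pathIntegral_add_adjacent hW hK 0 t (t + h)]
    exact abs_inv_mul_exp_add_sub_mul_exp_le hh hi hi (by simpa using by positivity) hsmall
      (hK _) hKh

theorem tendsto_eLpNorm_two_feynmanKac_sub_semigroup (hinv : M.IsInvariant μ)
    (hcont : M.IsStronglyContinuous μ) (hW : Measurable W) (hK : ∀ x, |W x| ≤ K) {t : ℝ}
    (ht : 0 ≤ t) :
    Tendsto (fun h : ℝ => eLpNorm (fun x => h⁻¹ * (M.feynmanKac W (t + h) 1 x -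
      M.semigroup h.toNNReal (M.feynmanKac W t 1) x) - W x * M.feynmanKac W t 1 x) 2 μ)
      (𝓝[>] 0) (𝓝 0) := by
  have hWX : Measurable fun ω => W (M.X 0 ω) := hW.comp (M.measurable_at 0)
  have hI := M.measurable_pathIntegral hW
  refine M.tendsto_eLpNorm_two_integral_law
    (D := fun h ω => h⁻¹ * (Real.exp (M.pathIntegral W 0 (h + t) ω) -
      Real.exp (M.pathIntegral W h (h + t) ω)) -
        W (M.X 0 ω) * Real.exp (M.pathIntegral W 0 t ω))
    (fun h => (((hI 0 _).exp.sub (hI h _).exp).const_mul _).sub (hWX.mul (hI 0 t).exp)) ?_ ?_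
  · filter_upwards [self_mem_nhdsWithin] with h (hh : 0 < h) x
    have hstart : ∫ ω, W (M.X 0 ω) * Real.exp (M.pathIntegral W 0 t ω) ∂M.law x =
        W x * ∫ ω, Real.exp (M.pathIntegral W 0 t ω) ∂M.law x := by
      rw [← integral_const_mul]
      exact integral_congr_ae ((M.start x).mono fun ω hω => by simp only [hω])
    rw [M.semigroup_feynmanKac_one hW hK hh.le ht, add_comm t h]
    simp_rw [M.feynmanKac_one]
    rw [← hstart]
    refine (integral_mul_sub_sub h⁻¹ (M.integrable_exp_pathIntegral _ hW hK (by positivity))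
      (M.integrable_exp_pathIntegral _ hW hK (by linarith)) ?_).symm
    exact (M.integrable_exp_pathIntegral _ hW hK ht).bdd_mul hWX.aestronglyMeasurable
      (ae_of_all _ fun ω => hK _)
  · have hlim := M.tendsto_eLpNorm_two_pathIntegral hinv hcont hW hK le_rfl
    simp only [zero_add, Real.toNNReal_zero] at hlim
    refine tendsto_eLpNorm_two_zero_of_abs_le (Real.exp (K * t)) (3 * Real.exp (K * t) * K ^ 2)
      (fun h => ((hI 0 h).const_mul _).sub hWX) ?_ hlim
    filter_upwards [self_mem_nhdsWithin, eventually_mul_le_one K] with h (hh : 0 < h) hKh ω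
    have hsmall : |M.pathIntegral W 0 h ω| ≤ K * h := by
      simpa [abs_of_pos hh] using M.abs_pathIntegral_le hK 0 h ω
    have hlast : |M.pathIntegral W t (h + t) ω| ≤ K * h := by
      simpa [abs_of_pos hh] using M.abs_pathIntegral_le hK t (h + t) ω
    have hsplit := M.pathIntegral_add_adjacent hW hK 0 h (h + t) ω
    have hsplit' := M.pathIntegral_add_adjacent hW hK 0 t (h + t) ω
    rw [← hsplit, add_comm (M.pathIntegral W 0 h ω)]
    refine abs_inv_mul_exp_add_sub_mul_exp_le hh ?_ ?_ ?_ hsmall (hK _) hKh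
    · simpa using M.pathIntegral_le hK (le_add_of_nonneg_right ht : h ≤ h + t) ω
    · simpa using M.pathIntegral_le hK ht ω
    · rw [abs_le] at hsmall hlast ⊢
      constructor <;> linarith

end MarkovProcess

theorem hasDerivWithinAt_integral_sq {α : Type*} [MeasurableSpace α] {μ : Measure α}
    {u : ℝ → α → ℝ} {v : α → ℝ} (hu : ∀ t, MemLp (u t) 2 μ) (hv : MemLp v 2 μ) {t : ℝ}
    (hlim : Tendsto (fun h => eLpNorm (fun x => h⁻¹ * (u (t + h) x - u t x) - v x) 2 μ)
      (𝓝[>] 0) (𝓝 0)) :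
    HasDerivWithinAt (fun s => ∫ x, u s x ^ 2 ∂μ) (2 * ∫ x, u t x * v x ∂μ) (Ioi t) t := by
  have hnormSq : ∀ s, ‖(hu s).toLp (u s)‖ ^ 2 = ∫ x, u s x ^ 2 ∂μ := fun s => by
    rw [Lp.norm_toLp, ← ENNReal.toReal_pow, eLpNorm_two_sq_eq_ofReal (hu s),
      ENNReal.toReal_ofReal (integral_nonneg fun _ => sq_nonneg _)]
  have hinner : inner ℝ ((hu t).toLp (u t)) (hv.toLp v) = ∫ x, u t x * v x ∂μ := by
    rw [L2.inner_def]
    refine integral_congr_ae ?_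
    filter_upwards [(hu t).coeFn_toLp, hv.coeFn_toLp] with x hx hx'
    rw [hx, hx', real_inner_eq_re_inner]
    simp [mul_comm]
  have hderiv : HasDerivWithinAt (fun s => (hu s).toLp (u s)) (hv.toLp v) (Ioi t) t := by
    have hnhds : map (t + ·) (𝓝[>] 0) = 𝓝[>] t := by simp
    rw [hasDerivWithinAt_iff_tendsto_slope' self_notMem_Ioi, ← hnhds, tendsto_map'_iff]
    refine ((Lp.tendsto_Lp_iff_tendsto_eLpNorm'' (fun h x => h⁻¹ * (u (t + h) x - u t x))
      (fun h => ((hu (t + h)).sub (hu t)).const_mul h⁻¹) v hv).2 hlim).congr fun h => ?_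
    rw [Function.comp_apply, slope_def_module, add_sub_cancel_left]
    rfl
  simpa only [hnormSq, hinner] using hderiv.norm_sq

theorem lintegral_ofReal_le_eLpNorm_rnDeriv_mul {α : Type*} [MeasurableSpace α] {μ ν : Measure α}
    [SigmaFinite μ] [SigmaFinite ν] (hν : ν ≪ μ) {u : α → ℝ} (hu : Measurable u) :
    ∫⁻ x, ENNReal.ofReal (u x) ∂ν ≤
      eLpNorm (fun x => (ν.rnDeriv μ x).toReal) 2 μ * eLpNorm u 2 μ := by
  rw [← lintegral_rnDeriv_mul hν hu.ennreal_ofReal.aemeasurable]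
  have hholder := eLpNorm_smul_le_mul_eLpNorm (μ := μ) (p := 2) (q := 2) (r := 1)
    hu.aestronglyMeasurable
    (ν.measurable_rnDeriv μ).ennreal_toReal.aestronglyMeasurable
  rw [eLpNorm_one_eq_lintegral_enorm] at hholder
  refine le_trans (lintegral_mono_ae ?_) hholder
  filter_upwards [ν.rnDeriv_lt_top μ] with x hx
  rw [Pi.smul_apply', enorm_smul, Real.enorm_eq_ofReal ENNReal.toReal_nonneg,
    ENNReal.ofReal_toReal hx.ne]
  gcongr
  exact Real.ofReal_le_enorm (u x)

namespace MarkovProcess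

variable {E Ω : Type*} [MeasurableSpace E] [MeasurableSpace Ω] (M : MarkovProcess E Ω)
  {W : E → ℝ} {K : ℝ} {μ : Measure E} [IsProbabilityMeasure μ]

theorem memLp_feynmanKac (hW : Measurable W) (hK : ∀ x, |W x| ≤ K) (t : ℝ) {g : E → ℝ}
    (hg : Measurable g) {C : ℝ} (hC : ∀ x, |g x| ≤ C) : MemLp (M.feynmanKac W t g) 2 μ :=
  memLp_of_abs_le (M.measurable_feynmanKac hW t hg) (M.abs_feynmanKac_le hK t hC) 2

theorem memLp_feynmanKac_one (hW : Measurable W) (hK : ∀ x, |W x| ≤ K) (t : ℝ) :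
    MemLp (M.feynmanKac W t 1) 2 μ :=
  M.memLp_feynmanKac hW hK t measurable_one fun _ => abs_one.le

theorem memLp_mul_feynmanKac_one (hW : Measurable W) (hK : ∀ x, |W x| ≤ K) (t : ℝ) :
    MemLp (fun x => W x * M.feynmanKac W t 1 x) 2 μ :=
  (M.memLp_feynmanKac_one hW hK t).mul
    (MemLp.of_bound hW.aestronglyMeasurable K (ae_of_all μ hK) : MemLp W ∞ μ)

theorem generatorGraph_feynmanKac (hinv : M.IsInvariant μ) (hcont : M.IsStronglyContinuous μ)
    (hW : Measurable W) (hK : ∀ x, |W x| ≤ K) {t : ℝ} (ht : 0 ≤ t) :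
    M.GeneratorGraph μ (M.feynmanKac W t 1)
      (fun x => M.feynmanKac W t W x - W x * M.feynmanKac W t 1 x) := by
  have hu := M.memLp_feynmanKac_one (μ := μ) hW hK t
  have hu' := M.measurable_feynmanKac hW t measurable_one
  have hforward := M.tendsto_eLpNorm_two_feynmanKac_slope hinv hcont hW hK ht
  have hbackward := M.tendsto_eLpNorm_two_feynmanKac_sub_semigroup hinv hcont hW hK ht
  refine ⟨hu, (M.memLp_feynmanKac hW hK t hW hK).sub (M.memLp_mul_feynmanKac_one hW hK t), ?_⟩
  have hsum := hforward.add hbackward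
  rw [add_zero] at hsum
  refine tendsto_nhdsGT_zero_of_toNNReal (g := fun h : ℝ => eLpNorm (fun x => h⁻¹ *
    (M.semigroup h.toNNReal (M.feynmanKac W t 1) x - M.feynmanKac W t 1 x) -
      (M.feynmanKac W t W x - W x * M.feynmanKac W t 1 x)) 2 μ)
    (fun h => by rw [Real.toNNReal_coe]) ?_
  refine tendsto_of_tendsto_of_tendsto_of_le_of_le tendsto_const_nhds hsum (fun _ => zero_le)
    fun h => ?_
  have := M.measurable_semigroup h.toNNReal hu'
  have := M.measurable_feynmanKac hW (t + h) measurable_one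
  have := M.measurable_feynmanKac hW t hW
  refine le_trans (le_of_eq ?_) (eLpNorm_sub_le (by fun_prop) (by fun_prop) one_le_two)
  congr 1
  ext x
  simp only [Pi.sub_apply]
  ring

theorem continuousOn_feynmanKac_one (hW : Measurable W) (hK : ∀ x, |W x| ≤ K) (T : ℝ) (x : E) :
    ContinuousOn (fun t => M.feynmanKac W t 1 x) (Icc 0 T) := by
  simp_rw [M.feynmanKac_one]
  refine continuousOn_of_dominated (bound := fun _ => Real.exp (K * T))
    (fun t _ => (M.measurable_pathIntegral hW 0 t).exp.aestronglyMeasurable)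
    (fun t ht => ae_of_all _ fun ω => ?_) (integrable_const _) (ae_of_all _ fun ω => ?_)
  · have hK0 : 0 ≤ K := (abs_nonneg _).trans (hK x)
    rw [Real.norm_eq_abs, Real.abs_exp, Real.exp_le_exp]
    calc M.pathIntegral W 0 t ω ≤ K * t := by simpa using M.pathIntegral_le hK ht.1 ω
      _ ≤ K * T := mul_le_mul_of_nonneg_left ht.2 hK0
  · exact (intervalIntegral.continuous_primitive
      (fun a b => M.intervalIntegrable_comp_X hW hK a b ω) 0).rexp.continuousOn

theorem continuousOn_integral_feynmanKac_sq (hW : Measurable W) (hK : ∀ x, |W x| ≤ K) (T : ℝ) :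
    ContinuousOn (fun t => ∫ x, M.feynmanKac W t 1 x ^ 2 ∂μ) (Icc 0 T) := by
  refine continuousOn_of_dominated (bound := fun _ => Real.exp (K * T) ^ 2)
    (fun t _ => ((M.measurable_feynmanKac hW t measurable_one).pow_const 2).aestronglyMeasurable)
    (fun t ht => ae_of_all _ fun x => ?_) (integrable_const _)
    (ae_of_all _ fun x => (M.continuousOn_feynmanKac_one hW hK T x).pow 2)
  have hK0 : 0 ≤ K := (abs_nonneg _).trans (hK x)
  rw [norm_pow, Real.norm_eq_abs]
  gcongr
  calc |M.feynmanKac W t 1 x| ≤ Real.exp (K * |t|) * 1 :=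
        M.abs_feynmanKac_le hK t (fun _ => abs_one.le) x
    _ ≤ Real.exp (K * T) := by
        rw [mul_one, abs_of_nonneg ht.1]
        gcongr
        exact ht.2

theorem integral_mul_sq_add_integral_generator (hW : Measurable W) (hK : ∀ x, |W x| ≤ K) (t : ℝ) :
    ∫ x, W x * M.feynmanKac W t 1 x ^ 2 ∂μ +
        ∫ x, (M.feynmanKac W t W x - W x * M.feynmanKac W t 1 x) * M.feynmanKac W t 1 x ∂μ =
      ∫ x, M.feynmanKac W t 1 x * M.feynmanKac W t W x ∂μ := by
  have hu := M.memLp_feynmanKac_one (μ := μ) hW hK t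
  have hWu := M.memLp_mul_feynmanKac_one (μ := μ) hW hK t
  have hWu2 : Integrable (fun x => W x * M.feynmanKac W t 1 x ^ 2) μ :=
    (hWu.integrable_mul hu).congr (ae_of_all _ fun x => by simp only [Pi.mul_apply]; ring)
  rw [← integral_add hWu2
    (by exact ((M.memLp_feynmanKac hW hK t hW hK).sub hWu).integrable_mul hu)]
  exact integral_congr_ae (ae_of_all _ fun x => by ring)

theorem integral_feynmanKac_sq_le (hinv : M.IsInvariant μ) (hcont : M.IsStronglyContinuous μ)
    (hW : Measurable W) (hK : ∀ x, |W x| ≤ K) {Λ : ℝ}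
    (hform : ∀ f g : E → ℝ, M.GeneratorGraph μ f g →
      ∫ x, W x * f x ^ 2 ∂μ + ∫ x, g x * f x ∂μ ≤ Λ * ∫ x, f x ^ 2 ∂μ) {t : ℝ} (ht : 0 ≤ t) :
    ∫ x, M.feynmanKac W t 1 x ^ 2 ∂μ ≤ Real.exp (2 * Λ * t) := by
  have hderiv : ∀ s, 0 ≤ s → HasDerivWithinAt (fun s => ∫ x, M.feynmanKac W s 1 x ^ 2 ∂μ)
      (2 * ∫ x, M.feynmanKac W s 1 x * M.feynmanKac W s W x ∂μ) (Ioi s) s := fun s hs =>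
    hasDerivWithinAt_integral_sq (M.memLp_feynmanKac_one hW hK)
      (M.memLp_feynmanKac hW hK s hW hK)
      (M.tendsto_eLpNorm_two_feynmanKac_slope hinv hcont hW hK hs)
  have hgrowth : ∀ s, 0 ≤ s → 2 * ∫ x, M.feynmanKac W s 1 x * M.feynmanKac W s W x ∂μ ≤
      2 * Λ * ∫ x, M.feynmanKac W s 1 x ^ 2 ∂μ + 0 := fun s hs => by
    have hbound := hform _ _ (M.generatorGraph_feynmanKac hinv hcont hW hK hs)
    rw [M.integral_mul_sq_add_integral_generator hW hK] at hbound
    linarith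
  have hinitial : ∫ x, M.feynmanKac W 0 1 x ^ 2 ∂μ ≤ 1 := by
    simp [feynmanKac, pathIntegral]
  have hgronwall := le_gronwallBound_of_liminf_deriv_right_le
    (M.continuousOn_integral_feynmanKac_sq hW hK t)
    (fun s hs r hr => (hderiv s hs.1).Ici_of_Ioi.liminf_right_slope_le hr) hinitial
    (fun s hs => hgrowth s hs.1) t (right_mem_Icc.2 ht)
  simpa [gronwallBound_ε0] using hgronwall

theorem eLpNorm_feynmanKac_le (hinv : M.IsInvariant μ) (hcont : M.IsStronglyContinuous μ)
    (hW : Measurable W) (hK : ∀ x, |W x| ≤ K) {Λ : ℝ}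
    (hform : ∀ f g : E → ℝ, M.GeneratorGraph μ f g →
      ∫ x, W x * f x ^ 2 ∂μ + ∫ x, g x * f x ∂μ ≤ Λ * ∫ x, f x ^ 2 ∂μ) {t : ℝ} (ht : 0 ≤ t) :
    eLpNorm (M.feynmanKac W t 1) 2 μ ≤ ENNReal.ofReal (Real.exp (Λ * t)) := by
  rw [← ENNReal.pow_le_pow_left_iff two_ne_zero,
    eLpNorm_two_sq_eq_ofReal (M.memLp_feynmanKac_one hW hK t),
    ← ENNReal.ofReal_pow (Real.exp_nonneg _), ← Real.exp_nat_mul]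
  refine ENNReal.ofReal_le_ofReal
    ((M.integral_feynmanKac_sq_le hinv hcont hW hK hform ht).trans_eq ?_)
  rw [mul_assoc, Nat.cast_ofNat]

theorem lintegral_exp_pathIntegral_le (hinv : M.IsInvariant μ) (hcont : M.IsStronglyContinuous μ)
    (hW : Measurable W) (hK : ∀ x, |W x| ≤ K) {Λ : ℝ}
    (hform : ∀ f g : E → ℝ, M.GeneratorGraph μ f g →
      ∫ x, W x * f x ^ 2 ∂μ + ∫ x, g x * f x ∂μ ≤ Λ * ∫ x, f x ^ 2 ∂μ)
    {ν : Measure E} [SigmaFinite ν] (hν : ν ≪ μ) {t : ℝ} (ht : 0 ≤ t) :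
    ∫⁻ ω, ENNReal.ofReal (Real.exp (M.pathIntegral W 0 t ω)) ∂M.lawFrom ν ≤
      eLpNorm (fun x => (ν.rnDeriv μ x).toReal) 2 μ * ENNReal.ofReal (Real.exp (Λ * t)) := by
  calc ∫⁻ ω, ENNReal.ofReal (Real.exp (M.pathIntegral W 0 t ω)) ∂M.lawFrom ν
      = ∫⁻ x, ENNReal.ofReal (M.feynmanKac W t 1 x) ∂ν := by
        rw [M.lintegral_lawFrom ν (M.measurable_pathIntegral hW 0 t).exp.ennreal_ofReal]
        refine lintegral_congr fun x => ?_
        rw [M.feynmanKac_one, ofReal_integral_eq_lintegral_ofReal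
          (M.integrable_exp_pathIntegral _ hW hK ht) (ae_of_all _ fun ω => Real.exp_nonneg _)]
    _ ≤ eLpNorm (fun x => (ν.rnDeriv μ x).toReal) 2 μ * eLpNorm (M.feynmanKac W t 1) 2 μ :=
        lintegral_ofReal_le_eLpNorm_rnDeriv_mul hν (M.measurable_feynmanKac hW t measurable_one)
    _ ≤ _ := by
        gcongr
        exact M.eLpNorm_feynmanKac_le hinv hcont hW hK hform ht

end MarkovProcess

theorem exists_supergradient_of_concaveOn {f : ℝ → ℝ} {S : Set ℝ} {x : ℝ}
    (hf : ConcaveOn ℝ S f) (hx : x ∈ interior S) : ∃ c, ∀ y ∈ S, f y ≤ f x + c * (y - x) := by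
  have hconvex : ConvexOn ℝ S (-f) := hf.neg
  refine ⟨-derivWithin (-f) (Ioi x) x, fun y hy => ?_⟩
  obtain hyx | rfl | hxy := lt_trichotomy y x
  · have hslope := (hconvex.slope_le_leftDeriv_of_mem_interior hy hx hyx).trans
      (hconvex.leftDeriv_le_rightDeriv_of_mem_interior hx)
    rw [slope_def_field, div_le_iff₀ (sub_pos.2 hyx), Pi.neg_apply, Pi.neg_apply] at hslope
    linarith
  · simp
  · have hslope := hconvex.rightDeriv_le_slope_of_mem_interior hx hy hxy
    rw [slope_def_field, le_div_iff₀ (sub_pos.2 hxy), Pi.neg_apply, Pi.neg_apply] at hslope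
    linarith

namespace IsSobolevFunction

variable {F : ℝ → ℝ}

theorem exists_eq (hF : IsSobolevFunction F) {w : ℝ} (hw : 0 ≤ w) : ∃ y ∈ Ioi (0 : ℝ), F y = w := by
  obtain ⟨b, hwb, hb⟩ := ((hF.tendsto_atTop.eventually_ge_atTop w).and
    (eventually_ge_atTop 1)).exists
  have hsub : Icc 1 b ⊆ Ioi (0 : ℝ) := fun y hy => zero_lt_one.trans_le hy.1
  obtain ⟨y, hy, hyw⟩ := intermediate_value_Icc hb (hF.continuousOn.mono hsub)
    ⟨hF.map_one.trans_le hw, hwb⟩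
  exact ⟨y, hsub hy, hyw⟩

theorem sobolevInv_pos (hF : IsSobolevFunction F) {w : ℝ} (hw : 0 ≤ w) : 0 < sobolevInv F w :=
  Function.invFunOn_mem (hF.exists_eq hw)

theorem apply_sobolevInv (hF : IsSobolevFunction F) {w : ℝ} (hw : 0 ≤ w) :
    F (sobolevInv F w) = w :=
  Function.invFunOn_eq (hF.exists_eq hw)

theorem sobolevInv_mono (hF : IsSobolevFunction F) {w w' : ℝ} (hw : 0 ≤ w) (hww' : w ≤ w') :
    sobolevInv F w ≤ sobolevInv F w' := by
  have hw' := hw.trans hww'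
  rwa [← hF.strictMonoOn.le_iff_le (hF.sobolevInv_pos hw) (hF.sobolevInv_pos hw'),
    hF.apply_sobolevInv hw, hF.apply_sobolevInv hw']

theorem sobolevInv_zero (hF : IsSobolevFunction F) : sobolevInv F 0 = 1 :=
  hF.strictMonoOn.injOn (hF.sobolevInv_pos le_rfl) (mem_Ioi.2 one_pos)
    (by rw [hF.apply_sobolevInv le_rfl, hF.map_one])

theorem one_le_sobolevInv (hF : IsSobolevFunction F) {w : ℝ} (hw : 0 ≤ w) :
    1 ≤ sobolevInv F w :=
  hF.sobolevInv_zero ▸ hF.sobolevInv_mono le_rfl hw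

theorem exists_supergradient (hF : IsSobolevFunction F) {J : ℝ} (hJ : 0 < J) :
    ∃ c, 0 ≤ c ∧ ∀ y, 0 < y → F y ≤ F J + c * (y - J) := by
  obtain ⟨c, hc⟩ := exists_supergradient_of_concaveOn hF.concaveOn
    (interior_maximal subset_rfl isOpen_Ioi (mem_Ioi.2 hJ))
  refine ⟨c, ?_, hc⟩
  have hlt := hF.strictMonoOn (mem_Ioi.2 hJ) (mem_Ioi.2 (hJ.trans (lt_add_one J))) (lt_add_one J)
  have hle := hc (J + 1) (hJ.trans (lt_add_one J))
  linarith

-- `F (F⁻¹ u) ≤ F (F⁻¹ u / p) + F p`, and the first term is bounded by the supergradient at `J`.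
theorem mul_le_of_supergradient (hF : IsSobolevFunction F) {c J u p : ℝ} (hc : 0 ≤ c)
    (hcJ : ∀ y, 0 < y → F y ≤ F J + c * (y - J)) (hu : 0 ≤ u) (hp : 0 ≤ p) :
    u * p ≤ (F J - c * J) * p + c * sobolevInv F u + p * F p := by
  have hinv := hF.sobolevInv_pos hu
  obtain rfl | hp := hp.eq_or_lt
  · simpa using mul_nonneg hc hinv.le
  have hmul := hF.map_mul_le (sobolevInv F u / p) p (div_pos hinv hp) hp
  rw [div_mul_cancel₀ _ hp.ne', hF.apply_sobolevInv hu] at hmul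
  calc u * p ≤ (F J + c * (sobolevInv F u / p - J) + F p) * p := by
        gcongr
        exact hmul.trans (by gcongr; exact hcJ _ (div_pos hinv hp))
    _ = _ := by field_simp; ring

variable {E : Type*} [MeasurableSpace E] {μ : Measure E} {U : E → ℝ}

theorem measurable_sobolevInv_comp (hF : IsSobolevFunction F) (hU : Measurable U)
    (hU0 : ∀ x, 0 ≤ U x) : Measurable fun x => sobolevInv F (U x) := by
  have hmono : Monotone fun w => sobolevInv F (max w 0) := fun a b hab =>
    hF.sobolevInv_mono (le_max_right _ _) (max_le_max_right 0 hab)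
  simpa only [Function.comp_def, max_eq_left (hU0 _)] using hmono.measurable.comp hU

theorem integrable_sobolevInv_of_le (hF : IsSobolevFunction F) {U' : E → ℝ}
    (hU : Measurable U) (hU0 : ∀ x, 0 ≤ U x) (hUU' : ∀ x, U x ≤ U' x)
    (hU' : Integrable (fun x => sobolevInv F (U' x)) μ) :
    Integrable (fun x => sobolevInv F (U x)) μ :=
  hU'.mono' (hF.measurable_sobolevInv_comp hU hU0).aestronglyMeasurable <| ae_of_all _ fun x => by
    rw [Real.norm_of_nonneg (hF.sobolevInv_pos (hU0 x)).le]
    exact hF.sobolevInv_mono (hU0 x) (hUU' x)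

variable [IsProbabilityMeasure μ]

theorem one_le_integral_sobolevInv (hF : IsSobolevFunction F) (hU0 : ∀ x, 0 ≤ U x)
    (hU : Integrable (fun x => sobolevInv F (U x)) μ) : 1 ≤ ∫ x, sobolevInv F (U x) ∂μ := by
  simpa using integral_mono (integrable_const 1) hU fun x => hF.one_le_sobolevInv (hU0 x)

/-- For `F = log` this is the Gibbs variational inequality
`∫ U p dμ ≤ log (∫ exp U dμ) + ∫ p log p dμ`. -/
theorem integral_mul_le (hF : IsSobolevFunction F) (hU : Measurable U) (hU0 : ∀ x, 0 ≤ U x)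
    (hUF : Integrable (fun x => sobolevInv F (U x)) μ) {p : E → ℝ} (hp0 : ∀ x, 0 ≤ p x)
    (hp : Integrable p μ) (hp1 : ∫ x, p x ∂μ = 1) (hpF : Integrable (fun x => p x * F (p x)) μ) :
    Integrable (fun x => U x * p x) μ ∧
      ∫ x, U x * p x ∂μ ≤ F (∫ x, sobolevInv F (U x) ∂μ) + ∫ x, p x * F (p x) ∂μ := by
  set J := ∫ x, sobolevInv F (U x) ∂μ
  obtain ⟨c, hc, hcJ⟩ := hF.exists_supergradient
    (one_pos.trans_le (hF.one_le_integral_sobolevInv hU0 hUF))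
  have hbound : ∀ x, U x * p x ≤ (F J - c * J) * p x + c * sobolevInv F (U x) + p x * F (p x) :=
    fun x => hF.mul_le_of_supergradient hc hcJ (hU0 x) (hp0 x)
  have hlinear : Integrable (fun x => (F J - c * J) * p x) μ := hp.const_mul _
  have hinv : Integrable (fun x => c * sobolevInv F (U x)) μ := hUF.const_mul _
  have hUp : Integrable (fun x => U x * p x) μ :=
    ((hlinear.add hinv).add hpF).mono' (hU.aestronglyMeasurable.mul hp.aestronglyMeasurable)
      (ae_of_all _ fun x => by
        rw [Real.norm_of_nonneg (mul_nonneg (hU0 x) (hp0 x))]; exact hbound x)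
  refine ⟨hUp, (integral_mono hUp ((hlinear.add hinv).add hpF) hbound).trans_eq ?_⟩
  rw [integral_add' (hlinear.add hinv) hpF, integral_add' hlinear hinv,
    integral_const_mul, integral_const_mul, hp1]
  ring

end IsSobolevFunction

namespace MarkovProcess

variable {E Ω : Type*} [MeasurableSpace E] [MeasurableSpace Ω] {M : MarkovProcess E Ω}
  {μ : Measure E} {f g : E → ℝ}

theorem IsInvariant.ae_integrable_transition (hinv : M.IsInvariant μ) (t : ℝ≥0)
    (hf : Integrable f μ) : ∀ᵐ x ∂μ, Integrable f (M.transition t x) :=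
  Measure.ae_integrable_of_integrable_comp
    (show Integrable f (μ.bind (M.transition t)) from (hinv t).symm ▸ hf)

theorem IsInvariant.integrable_semigroup (hinv : M.IsInvariant μ) (t : ℝ≥0)
    (hf : Integrable f μ) : Integrable (M.semigroup t f) μ := by
  rw [← show μ.bind (M.transition t) = μ from hinv t, Measure.comp_eq_comp_const_apply] at hf
  have hcomp := hf.integral_comp
  rwa [Kernel.const_apply] at hcomp

theorem GeneratorGraph.const_mul (h : M.GeneratorGraph μ f g) (c : ℝ) :
    M.GeneratorGraph μ (fun x => c * f x) (fun x => c * g x) := by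
  refine ⟨h.1.const_mul c, h.2.1.const_mul c, ?_⟩
  have hscale : ∀ t : ℝ≥0, eLpNorm (fun x => (t : ℝ)⁻¹ *
      (M.semigroup t (fun y => c * f y) x - c * f x) - c * g x) 2 μ =
        ‖c‖ₑ * eLpNorm (fun x => (t : ℝ)⁻¹ * (M.semigroup t f x - f x) - g x) 2 μ := fun t => by
    rw [← eLpNorm_const_smul]
    congr 1
    ext x
    rw [semigroup, integral_const_mul, Pi.smul_apply, smul_eq_mul, semigroup]
    ring
  simpa only [hscale, mul_zero] using ENNReal.Tendsto.const_mul h.2.2 (.inr enorm_ne_top)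

variable [IsProbabilityMeasure μ]

theorem GeneratorGraph.sub_const (hinv : M.IsInvariant μ) (h : M.GeneratorGraph μ f g) (a : ℝ) :
    M.GeneratorGraph μ (fun x => f x - a) g := by
  refine ⟨h.1.sub (memLp_const a), h.2.1, h.2.2.congr fun t => eLpNorm_congr_ae ?_⟩
  filter_upwards [hinv.ae_integrable_transition t (h.1.integrable one_le_two)] with x hx
  rw [semigroup, semigroup, integral_sub hx (integrable_const a), integral_const,
    probReal_univ, one_smul, sub_sub_sub_cancel_right]

theorem GeneratorGraph.integral_eq_zero (hinv : M.IsInvariant μ) (h : M.GeneratorGraph μ f g) :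
    ∫ x, g x ∂μ = 0 := by
  have hf : Integrable f μ := h.1.integrable one_le_two
  have hg : Integrable g μ := h.2.1.integrable one_le_two
  have hle : ∀ t : ℝ≥0, ‖∫ x, g x ∂μ‖ₑ ≤
      eLpNorm (fun x => (t : ℝ)⁻¹ * (M.semigroup t f x - f x) - g x) 2 μ := fun t => by
    have hslope : Integrable (fun x => (t : ℝ)⁻¹ * (M.semigroup t f x - f x)) μ :=
      ((hinv.integrable_semigroup t hf).sub hf).const_mul _
    calc ‖∫ x, g x ∂μ‖ₑ = ‖∫ x, ((t : ℝ)⁻¹ * (M.semigroup t f x - f x) - g x) ∂μ‖ₑ := by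
          rw [integral_sub hslope hg, integral_const_mul,
            integral_sub (hinv.integrable_semigroup t hf) hf, M.integral_semigroup hinv t hf,
            sub_self, mul_zero, zero_sub, enorm_neg]
      _ ≤ eLpNorm (fun x => (t : ℝ)⁻¹ * (M.semigroup t f x - f x) - g x) 1 μ := by
          rw [eLpNorm_one_eq_lintegral_enorm]
          exact enorm_integral_le_lintegral_enorm _
      _ ≤ _ := eLpNorm_le_eLpNorm_of_exponent_le one_le_two (hslope.sub hg).aestronglyMeasurable
  simpa using ge_of_tendsto' h.2.2 hle

theorem FSobolev.integral_mul_sq_le {F : ℝ → ℝ} (hSob : M.FSobolev μ F)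
    (hF : IsSobolevFunction F) {U : E → ℝ} (hU : Measurable U) (hU0 : ∀ x, 0 ≤ U x)
    (hUF : Integrable (fun x => sobolevInv F (U x)) μ) (h : M.GeneratorGraph μ f g) :
    Integrable (fun x => U x * f x ^ 2) μ ∧
      ∫ x, U x * f x ^ 2 ∂μ ≤
        F (∫ x, sobolevInv F (U x) ∂μ) * ∫ x, f x ^ 2 ∂μ - ∫ x, g x * f x ∂μ := by
  have hf := h.1.integrable_sq
  obtain hS | hS := (integral_nonneg fun x => sq_nonneg (f x) : 0 ≤ ∫ x, f x ^ 2 ∂μ).eq_or_lt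
  · have hf0 : f =ᵐ[μ] 0 := by
      filter_upwards [(integral_eq_zero_iff_of_nonneg (fun x => sq_nonneg (f x)) hf).1 hS.symm]
        with x hx using pow_eq_zero_iff two_ne_zero |>.1 hx
    have hUf : (fun x => U x * f x ^ 2) =ᵐ[μ] 0 := hf0.mono fun x hx => by simp [hx]
    have hgf : (fun x => g x * f x) =ᵐ[μ] 0 := hf0.mono fun x hx => by simp [hx]
    rw [integrable_congr hUf, integral_congr_ae hUf, integral_congr_ae hgf, ← hS]
    exact ⟨integrable_zero .., by simp⟩
  set S := ∫ x, f x ^ 2 ∂μ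
  set c := (√S)⁻¹
  have hc : c ^ 2 = S⁻¹ := by rw [inv_pow, Real.sq_sqrt hS.le]
  have hnorm : ∫ x, (c * f x) ^ 2 ∂μ = 1 := by
    simp_rw [mul_pow]
    rw [integral_const_mul, hc, inv_mul_cancel₀ hS.ne']
  obtain ⟨hentropy, henergy⟩ := hSob _ _ (h.const_mul c) hnorm
  obtain ⟨hUint, hUle⟩ := hF.integral_mul_le hU hU0 hUF (fun x => sq_nonneg (c * f x))
    (h.const_mul c).1.integrable_sq hnorm hentropy
  have hUscale : ∀ x, U x * (c * f x) ^ 2 = S⁻¹ * (U x * f x ^ 2) := fun x => by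
    rw [mul_pow, hc]; ring
  have hgscale : ∀ x, c * g x * (c * f x) = S⁻¹ * (g x * f x) := fun x => by rw [← hc]; ring
  simp_rw [hUscale] at hUint hUle
  simp_rw [hgscale] at henergy
  rw [integral_const_mul] at hUle henergy
  refine ⟨(integrable_const_mul_iff (inv_ne_zero hS.ne').isUnit _).1 hUint, ?_⟩
  have hle := (inv_mul_le_iff₀ hS).1 (hUle.trans (add_le_add_right henergy _))
  refine hle.trans_eq ?_
  rw [mul_add, mul_neg, mul_inv_cancel_left₀ hS.ne', mul_comm S, ← sub_eq_add_neg]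

end MarkovProcess

theorem integral_mul_const_add_sq_le {α : Type*} [MeasurableSpace α] {μ : Measure α}
    {B f : α → ℝ} (hB : Integrable B μ) (hB2 : Integrable (fun x => B x ^ 2) μ)
    (hf : Integrable (fun x => f x ^ 2) μ) (hBf : Integrable (fun x => B x * f x ^ 2) μ) (a : ℝ)
    (hBaf : Integrable (fun x => B x * (a + f x) ^ 2) μ) {c : ℝ} (hc : 0 < c) :
    ∫ x, B x * (a + f x) ^ 2 ∂μ ≤
      a ^ 2 * (∫ x, B x ∂μ + c * ∫ x, B x ^ 2 ∂μ) + (∫ x, f x ^ 2 ∂μ) / c +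
        ∫ x, B x * f x ^ 2 ∂μ := by
  have hyoung : ∀ x, B x * (a + f x) ^ 2 ≤
      a ^ 2 * (B x + c * B x ^ 2) + f x ^ 2 / c + B x * f x ^ 2 := fun x => by
    have hsq : 0 ≤ (c * (a * B x) - f x) ^ 2 / c := by positivity
    have hexpand : (c * (a * B x) - f x) ^ 2 / c =
        a ^ 2 * (c * B x ^ 2) - 2 * a * B x * f x + f x ^ 2 / c := by
      field_simp
      ring
    linarith
  have hmean : Integrable (fun x => a ^ 2 * (B x + c * B x ^ 2)) μ :=
    (hB.add (hB2.const_mul c)).const_mul _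
  refine (integral_mono hBaf ((hmean.add (hf.div_const c)).add hBf) hyoung).trans_eq ?_
  rw [integral_add' (hmean.add (hf.div_const c)) hBf, integral_add' hmean (hf.div_const c),
    integral_const_mul, integral_add hB (hB2.const_mul c), integral_const_mul, integral_div]

namespace MarkovProcess

variable {E Ω : Type*} [MeasurableSpace E] [MeasurableSpace Ω] {M : MarkovProcess E Ω}
  {μ : Measure E} {f g : E → ℝ}

theorem Poincare.integral_sub_mean_sq_le {C : ℝ} (hPoinc : M.Poincare μ C)
    (h : M.GeneratorGraph μ f g) :
    ∫ x, (f x - ∫ y, f y ∂μ) ^ 2 ∂μ ≤ -C * ∫ x, g x * f x ∂μ :=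
  variance_eq_integral h.1.aemeasurable ▸ hPoinc f g h

variable [IsProbabilityMeasure μ]

theorem GeneratorGraph.integral_mul_sub_const (hinv : M.IsInvariant μ)
    (h : M.GeneratorGraph μ f g) (a : ℝ) : ∫ x, g x * (f x - a) ∂μ = ∫ x, g x * f x ∂μ := by
  simp_rw [mul_sub]
  rw [integral_sub (by exact h.2.1.integrable_mul h.1) ((h.2.1.integrable one_le_two).mul_const a),
    integral_mul_const, h.integral_eq_zero hinv, zero_mul, sub_zero]

theorem integral_mul_centred_sq_le {F : ℝ → ℝ} (hF : IsSobolevFunction F) (hSob : M.FSobolev μ F)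
    {C : ℝ} (hC : 0 < C) {B U : E → ℝ} (hU : Measurable U) (hU0 : ∀ x, 0 ≤ U x)
    (hUint : Integrable (fun x => sobolevInv F (U x)) μ)
    (hUF : F (∫ x, sobolevInv F (U x) ∂μ) ≤ 1 / (4 * C))
    (hBU : ∀ x, B x ≤ 1 / (4 * C) + U x / 2) (h : M.GeneratorGraph μ f g)
    (hBf : Integrable (fun x => B x * f x ^ 2) μ)
    (hspectral : ∫ x, f x ^ 2 ∂μ ≤ -C * ∫ x, g x * f x ∂μ) :
    ∫ x, B x * f x ^ 2 ∂μ ≤ -(7 / 8) * ∫ x, g x * f x ∂μ := by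
  obtain ⟨hUf, hUle⟩ := hSob.integral_mul_sq_le hF hU hU0 hUint h
  have hf2 := h.1.integrable_sq
  have hS : 0 ≤ ∫ x, f x ^ 2 ∂μ := integral_nonneg fun x => sq_nonneg (f x)
  have henergy : 1 / (4 * C) * ∫ x, f x ^ 2 ∂μ ≤ -(1 / 4) * ∫ x, g x * f x ∂μ := by
    rw [one_div_mul_eq_div, div_le_iff₀ (by positivity)]
    linarith
  calc ∫ x, B x * f x ^ 2 ∂μ
      ≤ ∫ x, (1 / (4 * C) * f x ^ 2 + 1 / 2 * (U x * f x ^ 2)) ∂μ :=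
        integral_mono hBf ((hf2.const_mul _).add (hUf.const_mul _)) fun x => by
          linarith [mul_le_mul_of_nonneg_right (hBU x) (sq_nonneg (f x))]
    _ = 1 / (4 * C) * ∫ x, f x ^ 2 ∂μ + 1 / 2 * ∫ x, U x * f x ^ 2 ∂μ := by
        rw [integral_add (hf2.const_mul _) (hUf.const_mul _), integral_const_mul,
          integral_const_mul]
    _ ≤ _ := by linarith [mul_le_mul_of_nonneg_right hUF hS]

theorem integral_mul_sq_add_integral_generator_le (hinv : M.IsInvariant μ) {F : ℝ → ℝ}
    (hF : IsSobolevFunction F) (hSob : M.FSobolev μ F) {C : ℝ} (hC : 0 < C)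
    (hPoinc : M.Poincare μ C) {B U : E → ℝ} (hB : Measurable B) {K : ℝ} (hBK : ∀ x, |B x| ≤ K)
    (hU : Measurable U) (hU0 : ∀ x, 0 ≤ U x)
    (hUint : Integrable (fun x => sobolevInv F (U x)) μ)
    (hUF : F (∫ x, sobolevInv F (U x) ∂μ) ≤ 1 / (4 * C))
    (hBU : ∀ x, B x ≤ 1 / (4 * C) + U x / 2) (h : M.GeneratorGraph μ f g) :
    ∫ x, B x * f x ^ 2 ∂μ + ∫ x, g x * f x ∂μ ≤
      (|∫ x, B x ∂μ| + 8 * C * ∫ x, B x ^ 2 ∂μ) * ∫ x, f x ^ 2 ∂μ := by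
  set a := ∫ x, f x ∂μ
  have hcentred := h.sub_const hinv a
  have hmul : ∀ {p : E → ℝ}, Integrable p μ → Integrable (fun x => B x * p x) μ := fun hp =>
    hp.bdd_mul hB.aestronglyMeasurable (ae_of_all _ hBK)
  have hspectral := hPoinc.integral_sub_mean_sq_le h
  have hquadratic := integral_mul_centred_sq_le hF hSob hC hU hU0 hUint hUF hBU hcentred
    (hmul hcentred.1.integrable_sq) (by rwa [h.integral_mul_sub_const hinv])
  rw [h.integral_mul_sub_const hinv] at hquadratic
  have hexpand := integral_mul_const_add_sq_le (f := fun x => f x - a) (integrable_of_abs_le hB hBK)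
    (memLp_of_abs_le hB hBK 2).integrable_sq hcentred.1.integrable_sq
    (hmul hcentred.1.integrable_sq) a
    (by simpa only [add_sub_cancel] using hmul h.1.integrable_sq)
    (by positivity : 0 < 8 * C)
  simp only [add_sub_cancel] at hexpand
  have hcross : (∫ x, (f x - a) ^ 2 ∂μ) / (8 * C) ≤ -(1 / 8) * ∫ x, g x * f x ∂μ := by
    rw [div_le_iff₀ (by positivity)]
    linarith
  have hmean : a ^ 2 ≤ ∫ x, f x ^ 2 ∂μ := by
    have := variance_nonneg f μ
    rw [variance_eq_sub h.1] at this
    simpa using this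
  have _ : 0 ≤ ∫ x, B x ^ 2 ∂μ := integral_nonneg fun x => sq_nonneg (B x)
  calc ∫ x, B x * f x ^ 2 ∂μ + ∫ x, g x * f x ∂μ
      ≤ a ^ 2 * (∫ x, B x ∂μ + 8 * C * ∫ x, B x ^ 2 ∂μ) := by linarith
    _ ≤ a ^ 2 * (|∫ x, B x ∂μ| + 8 * C * ∫ x, B x ^ 2 ∂μ) := by gcongr; exact le_abs_self _
    _ ≤ (∫ x, f x ^ 2 ∂μ) * (|∫ x, B x ∂μ| + 8 * C * ∫ x, B x ^ 2 ∂μ) := by gcongr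
    _ = _ := mul_comm _ _

end MarkovProcess

section TruncatedPotential

variable {E : Type*} {V : E → ℝ} {C l l' : ℝ}

theorem truncatedPotential_eq_zero {x : E} (hx : l * V x ≤ 1 / (4 * C)) :
    truncatedPotential V C l x = 0 :=
  indicator_of_notMem (by exact not_lt.2 hx) _

theorem truncatedPotential_eq_mul {x : E} (hx : 1 / (4 * C) < l * V x) :
    truncatedPotential V C l x = 2 * l * V x :=
  indicator_of_mem (by exact hx) _

theorem truncatedPotential_nonneg (hC : 0 < C) (x : E) : 0 ≤ truncatedPotential V C l x := by
  obtain hx | hx := le_or_gt (l * V x) (1 / (4 * C))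
  · rw [truncatedPotential_eq_zero hx]
  · have hlV : 0 < l * V x := lt_trans (by positivity) hx
    rw [truncatedPotential_eq_mul hx]
    linarith

theorem truncatedPotential_mono (hC : 0 < C) (hl : 0 < l) (hll' : l ≤ l') (x : E) :
    truncatedPotential V C l x ≤ truncatedPotential V C l' x := by
  obtain hx | hx := le_or_gt (l * V x) (1 / (4 * C))
  · rw [truncatedPotential_eq_zero hx]
    exact truncatedPotential_nonneg hC x
  · have hV : 0 < V x := pos_of_mul_pos_right (lt_trans (by positivity) hx) hl.le
    have hlV : l * V x ≤ l' * V x := by gcongr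
    rw [truncatedPotential_eq_mul hx, truncatedPotential_eq_mul (hx.trans_le hlV)]
    linarith

theorem mul_le_add_truncatedPotential (hC : 0 < C) (x : E) :
    l * V x ≤ 1 / (4 * C) + truncatedPotential V C l x / 2 := by
  obtain hx | hx := le_or_gt (l * V x) (1 / (4 * C))
  · rwa [truncatedPotential_eq_zero hx, zero_div, add_zero]
  · rw [truncatedPotential_eq_mul hx]
    linarith [show 0 < 1 / (4 * C) by positivity]

theorem truncatedPotential_le_mul_posPart (hl : 0 < l) (hll' : 2 * l ≤ l') (x : E) :
    truncatedPotential V C l x ≤ l' * max (V x) 0 := by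
  have hpos : 0 ≤ l' * max (V x) 0 := mul_nonneg (by linarith) (le_max_right _ _)
  refine indicator_apply_le' (fun _ => ?_) fun _ => hpos
  calc 2 * l * V x ≤ 2 * l * max (V x) 0 := by gcongr; exact le_max_left _ _
    _ ≤ l' * max (V x) 0 := by gcongr

theorem measurable_truncatedPotential [MeasurableSpace E] (hV : Measurable V) :
    Measurable (truncatedPotential V C l) :=
  (hV.const_mul _).indicator (measurableSet_lt measurable_const (hV.const_mul _))

end TruncatedPotential

section LambdaOne

variable {E : Type*} [MeasurableSpace E] {μ : Measure E} {F : ℝ → ℝ} {V : E → ℝ} {C l₀ : ℝ}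

/-- The set of parameters `l` over which the supremum defining `λ₁` is taken. -/
def admissible (μ : Measure E) (F : ℝ → ℝ) (V : E → ℝ) (C l₀ : ℝ) : Set ℝ :=
  {l : ℝ | 0 < l ∧ l ≤ l₀ ∧ Integrable (fun x => sobolevInv F (truncatedPotential V C l x)) μ ∧
    F (∫ x, sobolevInv F (truncatedPotential V C l x) ∂μ) ≤ 1 / (4 * C)}

theorem bddAbove_admissible : BddAbove (admissible μ F V C l₀) := ⟨l₀, fun _ hl => hl.2.1⟩

theorem integrable_sobolevInv_truncatedPotential (hF : IsSobolevFunction F) (hC : 0 < C)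
    (hV : Measurable V) (hFV : Integrable (fun x => sobolevInv F (l₀ * max (V x) 0)) μ) {l : ℝ}
    (hl : 0 < l) (hll₀ : 2 * l ≤ l₀) :
    Integrable (fun x => sobolevInv F (truncatedPotential V C l x)) μ :=
  hF.integrable_sobolevInv_of_le (measurable_truncatedPotential hV) (truncatedPotential_nonneg hC)
    (truncatedPotential_le_mul_posPart hl hll₀) hFV

variable [IsProbabilityMeasure μ]

theorem admissible_of_le (hF : IsSobolevFunction F) (hC : 0 < C) (hV : Measurable V) {l l' : ℝ}
    (hl' : l' ∈ admissible μ F V C l₀) (hl : 0 < l) (hll' : l ≤ l') :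
    l ∈ admissible μ F V C l₀ := by
  obtain ⟨-, hl'₀, hint', hle'⟩ := hl'
  have hint := hF.integrable_sobolevInv_of_le (measurable_truncatedPotential hV)
    (truncatedPotential_nonneg hC) (truncatedPotential_mono hC hl hll') hint'
  refine ⟨hl, hll'.trans hl'₀, hint, le_trans ?_ hle'⟩
  have hone := hF.one_le_integral_sobolevInv (truncatedPotential_nonneg hC) hint
  have hmono : ∫ x, sobolevInv F (truncatedPotential V C l x) ∂μ ≤
      ∫ x, sobolevInv F (truncatedPotential V C l' x) ∂μ :=
    integral_mono hint hint' fun x =>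
      hF.sobolevInv_mono (truncatedPotential_nonneg hC x) (truncatedPotential_mono hC hl hll' x)
  exact hF.strictMonoOn.monotoneOn (mem_Ioi.2 (one_pos.trans_le hone))
    (mem_Ioi.2 (one_pos.trans_le (hone.trans hmono))) hmono

theorem tendsto_integral_sobolevInv_truncatedPotential (hF : IsSobolevFunction F) (hC : 0 < C)
    (hV : Measurable V) (hl₀ : 0 < l₀)
    (hFV : Integrable (fun x => sobolevInv F (l₀ * max (V x) 0)) μ) :
    Tendsto (fun l => ∫ x, sobolevInv F (truncatedPotential V C l x) ∂μ) (𝓝[>] 0) (𝓝 1) := by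
  have hsmall : ∀ᶠ l in 𝓝[>] (0 : ℝ), 0 < l ∧ 2 * l ≤ l₀ := by
    filter_upwards [Ioo_mem_nhdsGT (half_pos hl₀)] with l hl using ⟨hl.1, by linarith [hl.2]⟩
  rw [show (1 : ℝ) = ∫ _, 1 ∂μ by simp]
  refine tendsto_integral_filter_of_dominated_convergence _ (Eventually.of_forall fun l =>
    (hF.measurable_sobolevInv_comp (measurable_truncatedPotential hV)
      (truncatedPotential_nonneg hC)).aestronglyMeasurable) ?_ hFV (ae_of_all _ fun x => ?_)
  · filter_upwards [hsmall] with l hl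
    refine ae_of_all _ fun x => ?_
    rw [Real.norm_of_nonneg (hF.sobolevInv_pos (truncatedPotential_nonneg hC x)).le]
    exact hF.sobolevInv_mono (truncatedPotential_nonneg hC x)
      (truncatedPotential_le_mul_posPart hl.1 hl.2 x)
  · have hlV : Tendsto (fun l => l * V x) (𝓝[>] 0) (𝓝 0) :=
      tendsto_nhdsWithin_of_tendsto_nhds (by simpa using (continuous_mul_const (V x)).tendsto 0)
    refine tendsto_const_nhds.congr' ?_
    filter_upwards [hlV.eventually_le_const (show 0 < 1 / (4 * C) by positivity)] with l hl
    rw [truncatedPotential_eq_zero hl, hF.sobolevInv_zero]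

theorem admissible_nonempty (hF : IsSobolevFunction F) (hC : 0 < C) (hV : Measurable V)
    (hl₀ : 0 < l₀) (hFV : Integrable (fun x => sobolevInv F (l₀ * max (V x) 0)) μ) :
    (admissible μ F V C l₀).Nonempty := by
  have hF1 : Tendsto F (𝓝 1) (𝓝 0) :=
    hF.map_one ▸ hF.continuousOn.continuousAt (Ioi_mem_nhds one_pos)
  obtain ⟨l, hFl, hl⟩ := (((hF1.comp (tendsto_integral_sobolevInv_truncatedPotential hF hC hV hl₀
    hFV)).eventually_le_const (show 0 < 1 / (4 * C) by positivity)).and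
      (Ioo_mem_nhdsGT (half_pos hl₀))).exists
  exact ⟨l, hl.1, by linarith [hl.2], integrable_sobolevInv_truncatedPotential hF hC hV hFV hl.1
    (by linarith [hl.2]), hFl⟩

theorem lambdaOne_mem_Ioc (hF : IsSobolevFunction F) (hC : 0 < C) (hV : Measurable V)
    (hl₀ : 0 < l₀) (hFV : Integrable (fun x => sobolevInv F (l₀ * max (V x) 0)) μ) :
    lambdaOne μ F V C l₀ ∈ Ioc 0 l₀ := by
  obtain ⟨l, hl⟩ := admissible_nonempty hF hC hV hl₀ hFV
  exact ⟨hl.1.trans_le (le_csSup bddAbove_admissible hl), csSup_le ⟨l, hl⟩ fun _ h => h.2.1⟩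

theorem admissible_of_lt_lambdaOne (hF : IsSobolevFunction F) (hC : 0 < C) (hV : Measurable V)
    (hl₀ : 0 < l₀) (hFV : Integrable (fun x => sobolevInv F (l₀ * max (V x) 0)) μ) {l : ℝ}
    (hl : l ∈ Ioo 0 (lambdaOne μ F V C l₀)) : l ∈ admissible μ F V C l₀ := by
  obtain ⟨l', hl', hll'⟩ := exists_lt_of_lt_csSup (admissible_nonempty hF hC hV hl₀ hFV) hl.2
  exact admissible_of_le hF hC hV hl' hl.1 hll'.le

end LambdaOne

section DeviationRate

variable {m C l₁ R : ℝ}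

theorem deviationRate_eq_of_le (hC : 0 < C) (hR : 0 < R) (hRl₁ : R ≤ 16 * m ^ 2 * C * l₁) :
    deviationRate m C l₁ R = R ^ 2 / (32 * m ^ 2 * C) := by
  have hm : m ≠ 0 := by
    rintro rfl
    norm_num at hRl₁
    exact hR.not_ge hRl₁
  refine IsGreatest.csSup_eq ⟨⟨R / (16 * m ^ 2 * C), ⟨by positivity, ?_⟩, ?_⟩, ?_⟩
  · rwa [div_le_iff₀' (by positivity)]
  · dsimp only
    field_simp
    ring
  · rintro _ ⟨l, -, rfl⟩
    dsimp only
    rw [le_div_iff₀ (by positivity)]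
    linarith [sq_nonneg (R - 16 * m ^ 2 * C * l)]

theorem deviationRate_eq_of_ge (hC : 0 ≤ C) (hl₁ : 0 ≤ l₁) (hRl₁ : 16 * m ^ 2 * C * l₁ ≤ R) :
    deviationRate m C l₁ R = l₁ * R - 8 * m ^ 2 * C * l₁ ^ 2 := by
  refine IsGreatest.csSup_eq ⟨⟨l₁, ⟨hl₁, le_rfl⟩, by ring⟩, ?_⟩
  rintro _ ⟨l, hl, rfl⟩
  have hml : m ^ 2 * C * l ≤ m ^ 2 * C * l₁ := by gcongr; exact hl.2
  have hgap : 0 ≤ (l₁ - l) * (R - 8 * (m ^ 2 * C * l₁ + m ^ 2 * C * l)) :=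
    mul_nonneg (sub_nonneg.2 hl.2) (by linarith)
  linarith

theorem exists_deviationRate_eq (hl₁ : 0 ≤ l₁) :
    ∃ l ∈ Icc 0 l₁, deviationRate m C l₁ R = R * l - 8 * m ^ 2 * C * l ^ 2 :=
  isCompact_Icc.exists_sSup_image_eq ⟨0, le_rfl, hl₁⟩
    (by fun_prop : Continuous fun l : ℝ => R * l - 8 * m ^ 2 * C * l ^ 2).continuousOn

end DeviationRate

section Truncation

variable {α : Type*} {f : α → ℝ}

theorem measurable_truncation [MeasurableSpace α] (hf : Measurable f) (A : ℝ) :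
    Measurable (truncation f A) :=
  (measurable_id.indicator measurableSet_Ioc).comp hf

theorem truncation_le_of_nonneg {x : α} {c : ℝ} (hc : 0 ≤ c) (hfc : f x ≤ c) (A : ℝ) :
    truncation f A x ≤ c :=
  indicator_apply_le' (fun _ => hfc) fun _ => hc

theorem tendsto_truncation (f : α → ℝ) (x : α) :
    Tendsto (fun A => truncation f A x) atTop (𝓝 (f x)) := by
  refine tendsto_const_nhds.congr' ?_
  filter_upwards [eventually_gt_atTop |f x|] with A hA using (truncation_eq_self hA).symm

end Truncation

namespace MarkovProcess

variable {E Ω : Type*} [MeasurableSpace E] [MeasurableSpace Ω] (M : MarkovProcess E Ω)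
  {μ ν : Measure E}

theorem lintegral_lawFrom_comp_X (hinv : M.IsInvariant μ) (s : ℝ≥0) {f : E → ℝ≥0∞}
    (hf : Measurable f) : ∫⁻ ω, f (M.X s ω) ∂M.lawFrom μ = ∫⁻ x, f x ∂μ := by
  rw [M.lintegral_lawFrom μ (by exact hf.comp (M.measurable_at s))]
  simp_rw [← M.lintegral_transition s _ hf]
  rw [← Measure.lintegral_bind (M.transition s).measurable.aemeasurable hf.aemeasurable]
  congr 1
  exact hinv s

theorem ae_lawFrom_of_absolutelyContinuous (hν : ν ≪ μ) {s : Set Ω} (hs : MeasurableSet s)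
    (h : ∀ᵐ ω ∂M.lawFrom μ, ω ∈ s) : ∀ᵐ ω ∂M.lawFrom ν, ω ∈ s :=
  Measure.ae_comp_of_ae_ae hs (hν.ae_le (Measure.ae_ae_of_ae_comp h))

theorem ae_intervalIntegrable_comp_X [SFinite μ] (hinv : M.IsInvariant μ) {V : E → ℝ}
    (hV : Measurable V) (hVint : Integrable V μ) (hν : ν ≪ μ) {t : ℝ} (ht : 0 ≤ t) :
    ∀ᵐ ω ∂M.lawFrom ν, IntervalIntegrable (fun s : ℝ => V (M.X s.toNNReal ω)) volume 0 t := by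
  have hpath : Measurable (Function.uncurry fun (s : ℝ) ω => V (M.X s.toNNReal ω)) := by
    simpa only [zero_add] using M.measurable_uncurry_shift hV 0
  have hmeas : Measurable fun ω => ∫⁻ s in Ioc 0 t, ‖V (M.X s.toNNReal ω)‖ₑ :=
    hpath.enorm.lintegral_prod_left'
  have hfinite : ∀ᵐ ω ∂M.lawFrom μ, ∫⁻ s in Ioc 0 t, ‖V (M.X s.toNNReal ω)‖ₑ < ∞ := by
    have : SFinite (M.lawFrom μ) := inferInstanceAs (SFinite (M.law ∘ₘ μ))
    refine ae_lt_top hmeas ?_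
    rw [lintegral_lintegral_swap (hpath.comp measurable_swap).enorm.aemeasurable]
    simp_rw [M.lintegral_lawFrom_comp_X hinv _ hV.enorm]
    rw [lintegral_const, Measure.restrict_apply_univ, Real.volume_Ioc]
    exact ENNReal.mul_ne_top hVint.2.ne ENNReal.ofReal_ne_top
  filter_upwards [M.ae_lawFrom_of_absolutelyContinuous hν
    (measurableSet_lt hmeas measurable_const) hfinite] with ω hω
  rw [intervalIntegrable_iff_integrableOn_Ioc_of_le ht]
  exact ⟨(hpath.comp measurable_prodMk_right).aestronglyMeasurable, hω⟩

theorem tendsto_pathIntegral_truncation {V : E → ℝ} (hV : Measurable V) {t : ℝ} {ω : Ω}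
    (hω : IntervalIntegrable (fun s : ℝ => V (M.X s.toNNReal ω)) volume 0 t) :
    Tendsto (fun A => M.pathIntegral (truncation V A) 0 t ω) atTop
      (𝓝 (M.pathIntegral V 0 t ω)) := by
  have hpath : Measurable fun s : ℝ => M.X s.toNNReal ω :=
    M.measurable_X.comp (by fun_prop : Measurable fun s : ℝ => (s.toNNReal, ω))
  exact intervalIntegral.tendsto_integral_filter_of_dominated_convergence
    (fun s => |V (M.X s.toNNReal ω)|)
    (Eventually.of_forall fun A =>
      ((measurable_truncation hV A).comp hpath).aestronglyMeasurable)
    (Eventually.of_forall fun A => ae_of_all _ fun s _ => abs_truncation_le_abs_self _ _ _)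
    hω.abs (ae_of_all _ fun s _ => tendsto_truncation _ _)

theorem lintegral_exp_pathIntegral_le_liminf_truncation [SFinite μ] (hinv : M.IsInvariant μ)
    {V : E → ℝ} (hV : Measurable V) (hVint : Integrable V μ) (hν : ν ≪ μ) {t : ℝ} (ht : 0 ≤ t) :
    ∫⁻ ω, ENNReal.ofReal (Real.exp (M.pathIntegral V 0 t ω)) ∂M.lawFrom ν ≤
      liminf (fun n : ℕ => ∫⁻ ω, ENNReal.ofReal
        (Real.exp (M.pathIntegral (truncation V n) 0 t ω)) ∂M.lawFrom ν) atTop := by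
  have hlim : ∀ᵐ ω ∂M.lawFrom ν, ENNReal.ofReal (Real.exp (M.pathIntegral V 0 t ω)) =
      liminf (fun n : ℕ => ENNReal.ofReal
        (Real.exp (M.pathIntegral (truncation V n) 0 t ω))) atTop := by
    filter_upwards [M.ae_intervalIntegrable_comp_X hinv hV hVint hν ht] with ω hω
    exact (((ENNReal.continuous_ofReal.comp Real.continuous_exp).tendsto _).comp
      ((M.tendsto_pathIntegral_truncation hV hω).comp tendsto_natCast_atTop_atTop)).liminf_eq.symm
  rw [lintegral_congr_ae hlim]
  exact lintegral_liminf_le fun n =>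
    (M.measurable_pathIntegral (measurable_truncation hV n) 0 t).exp.ennreal_ofReal

variable [IsProbabilityMeasure μ] [SigmaFinite ν] {F : ℝ → ℝ} {C t : ℝ}

theorem lintegral_exp_pathIntegral_truncation_le (hinv : M.IsInvariant μ)
    (hcont : M.IsStronglyContinuous μ) (hF : IsSobolevFunction F) (hSob : M.FSobolev μ F)
    (hC : 0 < C) (hPoinc : M.Poincare μ C) {B U : E → ℝ} (hB : Measurable B) (hB2 : MemLp B 2 μ)
    (hU : Measurable U) (hU0 : ∀ x, 0 ≤ U x)
    (hUint : Integrable (fun x => sobolevInv F (U x)) μ)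
    (hUF : F (∫ x, sobolevInv F (U x) ∂μ) ≤ 1 / (4 * C))
    (hBU : ∀ x, B x ≤ 1 / (4 * C) + U x / 2) (hν : ν ≪ μ) (ht : 0 ≤ t) (A : ℝ) :
    ∫⁻ ω, ENNReal.ofReal (Real.exp (M.pathIntegral (truncation B A) 0 t ω)) ∂M.lawFrom ν ≤
      eLpNorm (fun x => (ν.rnDeriv μ x).toReal) 2 μ *
        ENNReal.ofReal (Real.exp ((|∫ x, truncation B A x ∂μ| + 8 * C * ∫ x, B x ^ 2 ∂μ) * t)) := by
  have hmeas := measurable_truncation hB A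
  have hbound := abs_truncation_le_bound B A
  have hsq : ∫ x, truncation B A x ^ 2 ∂μ ≤ ∫ x, B x ^ 2 ∂μ :=
    integral_mono (memLp_of_abs_le hmeas hbound 2).integrable_sq hB2.integrable_sq fun x =>
      sq_le_sq.2 (abs_truncation_le_abs_self B A x)
  have hmajorant : ∀ x, truncation B A x ≤ 1 / (4 * C) + U x / 2 := fun x =>
    truncation_le_of_nonneg (add_nonneg (by positivity) (div_nonneg (hU0 x) zero_le_two)) (hBU x) A
  refine M.lintegral_exp_pathIntegral_le hinv hcont hmeas hbound (fun f g h => ?_) hν ht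
  refine (integral_mul_sq_add_integral_generator_le hinv hF hSob hC hPoinc hmeas hbound hU hU0
    hUint hUF hmajorant h).trans ?_
  have _ : 0 ≤ ∫ x, f x ^ 2 ∂μ := integral_nonneg fun x => sq_nonneg (f x)
  gcongr

theorem lintegral_exp_pathIntegral_le_of_memLp (hinv : M.IsInvariant μ)
    (hcont : M.IsStronglyContinuous μ) (hF : IsSobolevFunction F) (hSob : M.FSobolev μ F)
    (hC : 0 < C) (hPoinc : M.Poincare μ C) {B U : E → ℝ} (hB : Measurable B) (hB2 : MemLp B 2 μ)
    (hU : Measurable U) (hU0 : ∀ x, 0 ≤ U x)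
    (hUint : Integrable (fun x => sobolevInv F (U x)) μ)
    (hUF : F (∫ x, sobolevInv F (U x) ∂μ) ≤ 1 / (4 * C))
    (hBU : ∀ x, B x ≤ 1 / (4 * C) + U x / 2) (hν : ν ≪ μ) (ht : 0 ≤ t) :
    ∫⁻ ω, ENNReal.ofReal (Real.exp (M.pathIntegral B 0 t ω)) ∂M.lawFrom ν ≤
      eLpNorm (fun x => (ν.rnDeriv μ x).toReal) 2 μ *
        ENNReal.ofReal (Real.exp ((|∫ x, B x ∂μ| + 8 * C * ∫ x, B x ^ 2 ∂μ) * t)) := by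
  have hBint : Integrable B μ := hB2.integrable one_le_two
  have hrate : Continuous fun b : ℝ =>
      ENNReal.ofReal (Real.exp ((|b| + 8 * C * ∫ x, B x ^ 2 ∂μ) * t)) :=
    ENNReal.continuous_ofReal.comp (by fun_prop)
  have hlim := ENNReal.Tendsto.const_mul (a := eLpNorm (fun x => (ν.rnDeriv μ x).toReal) 2 μ)
    ((hrate.tendsto _).comp
      ((tendsto_integral_truncation hBint).comp tendsto_natCast_atTop_atTop))
    (Or.inl (ENNReal.ofReal_pos.2 (Real.exp_pos _)).ne')
  refine (M.lintegral_exp_pathIntegral_le_liminf_truncation hinv hB hBint hν ht).trans ?_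
  rw [← hlim.liminf_eq]
  exact liminf_le_liminf (Eventually.of_forall fun n =>
    M.lintegral_exp_pathIntegral_truncation_le hinv hcont hF hSob hC hPoinc hB hB2 hU hU0 hUint
      hUF hBU hν ht n)

variable {V : E → ℝ} {m l l₀ : ℝ}

theorem lintegral_exp_mul_integral_le (hinv : M.IsInvariant μ) (hcont : M.IsStronglyContinuous μ)
    (hF : IsSobolevFunction F) (hSob : M.FSobolev μ F) (hC : 0 < C) (hPoinc : M.Poincare μ C)
    (hV : Measurable V) (hV2 : MemLp V 2 μ) (hV0 : ∫ x, V x ∂μ = 0)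
    (hm : ∫ x, V x ^ 2 ∂μ = m ^ 2) (hl : l ∈ admissible μ F V C l₀) (hν : ν ≪ μ) (ht : 0 ≤ t) :
    ∫⁻ ω, ENNReal.ofReal (Real.exp (l * M.pathIntegral V 0 t ω)) ∂M.lawFrom ν ≤
      eLpNorm (fun x => (ν.rnDeriv μ x).toReal) 2 μ *
        ENNReal.ofReal (Real.exp (8 * m ^ 2 * C * l ^ 2 * t)) := by
  have hmoment := M.lintegral_exp_pathIntegral_le_of_memLp hinv hcont hF hSob hC hPoinc
    (hV.const_mul l) (hV2.const_mul l) (measurable_truncatedPotential hV)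
    (truncatedPotential_nonneg hC) hl.2.2.1 hl.2.2.2 (mul_le_add_truncatedPotential hC) hν ht
  have hconst : 8 * C * (l ^ 2 * m ^ 2) * t = 8 * m ^ 2 * C * l ^ 2 * t := by ring
  simpa only [pathIntegral, intervalIntegral.integral_const_mul, integral_const_mul, mul_pow, hV0,
    hm, mul_zero, abs_zero, zero_add, hconst] using hmoment

theorem lawFrom_average_ge_le (hinv : M.IsInvariant μ) (hcont : M.IsStronglyContinuous μ)
    (hF : IsSobolevFunction F) (hSob : M.FSobolev μ F) (hC : 0 < C) (hPoinc : M.Poincare μ C)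
    (hV : Measurable V) (hV2 : MemLp V 2 μ) (hV0 : ∫ x, V x ∂μ = 0)
    (hm : ∫ x, V x ^ 2 ∂μ = m ^ 2) (hl : l ∈ admissible μ F V C l₀) (hν : ν ≪ μ) (ht : 0 < t)
    (R : ℝ) :
    M.lawFrom ν {ω | R ≤ (1 / t) * M.pathIntegral V 0 t ω} ≤
      eLpNorm (fun x => (ν.rnDeriv μ x).toReal) 2 μ *
        ENNReal.ofReal (Real.exp (-t * (R * l - 8 * m ^ 2 * C * l ^ 2))) := by
  have hexp : 0 < Real.exp (l * (R * t)) := Real.exp_pos _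
  calc M.lawFrom ν {ω | R ≤ (1 / t) * M.pathIntegral V 0 t ω}
      ≤ M.lawFrom ν {ω | ENNReal.ofReal (Real.exp (l * (R * t))) ≤
          ENNReal.ofReal (Real.exp (l * M.pathIntegral V 0 t ω))} := by
        refine measure_mono fun ω (hω : R ≤ _) => ?_
        rw [one_div, ← div_eq_inv_mul, le_div_iff₀ ht] at hω
        exact ENNReal.ofReal_le_ofReal
          (Real.exp_le_exp.2 (mul_le_mul_of_nonneg_left hω hl.1.le))
    _ ≤ (∫⁻ ω, ENNReal.ofReal (Real.exp (l * M.pathIntegral V 0 t ω)) ∂M.lawFrom ν) /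
          ENNReal.ofReal (Real.exp (l * (R * t))) :=
        meas_ge_le_lintegral_div
          ((M.measurable_pathIntegral hV 0 t).const_mul l).exp.ennreal_ofReal.aemeasurable
          (ENNReal.ofReal_pos.2 hexp).ne' ENNReal.ofReal_ne_top
    _ ≤ eLpNorm (fun x => (ν.rnDeriv μ x).toReal) 2 μ *
          ENNReal.ofReal (Real.exp (8 * m ^ 2 * C * l ^ 2 * t)) /
          ENNReal.ofReal (Real.exp (l * (R * t))) := by
        gcongr
        exact M.lintegral_exp_mul_integral_le hinv hcont hF hSob hC hPoinc hV hV2 hV0 hm hl hν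
          ht.le
    _ = _ := by
        rw [mul_div_assoc, ← ENNReal.ofReal_div_of_pos hexp, ← Real.exp_sub]
        congr 3
        ring

theorem lawFrom_average_ge_le_deviationRate (hinv : M.IsInvariant μ)
    (hcont : M.IsStronglyContinuous μ) (hF : IsSobolevFunction F) (hSob : M.FSobolev μ F)
    (hC : 0 < C) (hPoinc : M.Poincare μ C) (hV : Measurable V) (hV2 : MemLp V 2 μ)
    (hV0 : ∫ x, V x ∂μ = 0) (hm : ∫ x, V x ^ 2 ∂μ = m ^ 2) (hl₀ : 0 < l₀)
    (hFV : Integrable (fun x => sobolevInv F (l₀ * max (V x) 0)) μ) (hν : ν ≪ μ) (ht : 0 < t)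
    (R : ℝ) :
    M.lawFrom ν {ω | R ≤ (1 / t) * M.pathIntegral V 0 t ω} ≤
      eLpNorm (fun x => (ν.rnDeriv μ x).toReal) 2 μ *
        ENNReal.ofReal (Real.exp (-t * deviationRate m C (lambdaOne μ F V C l₀) R)) := by
  have hl₁ : 0 < lambdaOne μ F V C l₀ := (lambdaOne_mem_Ioc hF hC hV hl₀ hFV).1
  obtain ⟨l, hl, hrate⟩ := exists_deviationRate_eq (m := m) (C := C) (R := R) hl₁.le
  have hbound : Continuous fun l : ℝ => eLpNorm (fun x => (ν.rnDeriv μ x).toReal) 2 μ *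
      ENNReal.ofReal (Real.exp (-t * (R * l - 8 * m ^ 2 * C * l ^ 2))) :=
    continuous_iff_continuousAt.2 fun l => ENNReal.Tendsto.const_mul
      ((ENNReal.continuous_ofReal.comp (by fun_prop)).tendsto l)
      (Or.inl (ENNReal.ofReal_pos.2 (Real.exp_pos _)).ne')
  rw [hrate]
  -- The supremum may be attained at an endpoint of `[0, λ₁]`, where admissibility can fail.
  rw [← closure_Ioo hl₁.ne] at hl
  exact le_on_closure (fun l' hl' => M.lawFrom_average_ge_le hinv hcont hF hSob hC hPoinc hV hV2 hV0
    hm (admissible_of_lt_lambdaOne hF hC hV hl₀ hFV hl') hν ht R)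
    continuousOn_const hbound.continuousOn hl

end MarkovProcess

end

theorem mainTheorem3_general {E Ω : Type*} [MeasurableSpace E] [MeasurableSpace Ω]
    (M : MarkovProcess E Ω) (μ : Measure E) [IsProbabilityMeasure μ]
    (hinv : M.IsInvariant μ) (hcont : M.IsStronglyContinuous μ)
    (F : ℝ → ℝ) (hF : IsSobolevFunction F) (hSob : M.FSobolev μ F)
    (C_P : ℝ) (hC : 0 < C_P) (hPoinc : M.Poincare μ C_P)
    (V : E → ℝ) (hVmeas : Measurable V) (hV2 : MemLp V 2 μ) (hV0 : ∫ x, V x ∂μ = 0)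
    (m : ℝ) (hm : ∫ x, V x ^ 2 ∂μ = m ^ 2)
    (l₀ : ℝ) (hl₀ : 0 < l₀) (hFV : Integrable (fun x => sobolevInv F (l₀ * max (V x) 0)) μ) :
    (0 < lambdaOne μ F V C_P l₀ ∧ lambdaOne μ F V C_P l₀ ≤ l₀) ∧
    (∀ (ν : Measure E) [SigmaFinite ν], ν ≪ μ → ∀ t : ℝ, 0 < t →
      (∀ᵐ ω ∂(M.lawFrom ν),
        IntervalIntegrable (fun s : ℝ => V (M.X s.toNNReal ω)) volume 0 t) ∧
      ∀ R : ℝ,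
        M.lawFrom ν {ω | R ≤ (1 / t) * ∫ s in (0 : ℝ)..t, V (M.X s.toNNReal ω)} ≤
          eLpNorm (fun x => (ν.rnDeriv μ x).toReal) 2 μ *
            ENNReal.ofReal
              (Real.exp (-t * deviationRate m C_P (lambdaOne μ F V C_P l₀) R))) ∧
    (∀ R : ℝ, 0 < R →
      (R ≤ 16 * m ^ 2 * C_P * lambdaOne μ F V C_P l₀ →
        deviationRate m C_P (lambdaOne μ F V C_P l₀) R = R ^ 2 / (32 * m ^ 2 * C_P)) ∧
      (16 * m ^ 2 * C_P * lambdaOne μ F V C_P l₀ ≤ R →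
        deviationRate m C_P (lambdaOne μ F V C_P l₀) R =
          lambdaOne μ F V C_P l₀ * R - 8 * m ^ 2 * C_P * lambdaOne μ F V C_P l₀ ^ 2)) := by
  have hl₁ := lambdaOne_mem_Ioc hF hC hVmeas hl₀ hFV
  refine ⟨hl₁, fun ν _ hν t ht => ⟨?_, fun R => ?_⟩, fun R hR =>
    ⟨deviationRate_eq_of_le hC hR, deviationRate_eq_of_ge hC.le hl₁.1.le⟩⟩
  · exact M.ae_intervalIntegrable_comp_X hinv hVmeas (hV2.integrable one_le_two) hν ht.le
  · exact M.lawFrom_average_ge_le_deviationRate hinv hcont hF hSob hC hPoinc hVmeas hV2 hV0 hm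
      hl₀ hFV hν ht R

theorem mainTheorem3 {E Ω : Type*} [TopologicalSpace E] [PolishSpace E] [MeasurableSpace E]
    [BorelSpace E] [MeasurableSpace Ω] (M : MarkovProcess E Ω)
    (μ : Measure E) [IsProbabilityMeasure μ]
    (hinv : M.IsInvariant μ) (hcont : M.IsStronglyContinuous μ)
    (F : ℝ → ℝ) (hF : IsSobolevFunction F) (hSob : M.FSobolev μ F)
    (C_P : ℝ) (hC : 0 < C_P) (hPoinc : M.Poincare μ C_P)
    (V : E → ℝ) (hVmeas : Measurable V) (hV2 : MemLp V 2 μ) (hV0 : ∫ x, V x ∂μ = 0)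
    (m : ℝ) (hm : ∫ x, V x ^ 2 ∂μ = m ^ 2)
    (l₀ : ℝ) (hl₀ : 0 < l₀) (hFV : Integrable (fun x => sobolevInv F (l₀ * max (V x) 0)) μ) :
    (0 < lambdaOne μ F V C_P l₀ ∧ lambdaOne μ F V C_P l₀ ≤ l₀) ∧
    (∀ (ν : Measure E) [IsProbabilityMeasure ν], ν ≪ μ → ∀ t : ℝ, 0 < t →
      (∀ᵐ ω ∂(M.lawFrom ν),
        IntervalIntegrable (fun s : ℝ => V (M.X s.toNNReal ω)) volume 0 t) ∧
      ∀ R : ℝ, 0 < R →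
        M.lawFrom ν {ω | R ≤ (1 / t) * ∫ s in (0 : ℝ)..t, V (M.X s.toNNReal ω)} ≤
          eLpNorm (fun x => (ν.rnDeriv μ x).toReal) 2 μ *
            ENNReal.ofReal
              (Real.exp (-t * deviationRate m C_P (lambdaOne μ F V C_P l₀) R))) ∧
    (∀ R : ℝ, 0 < R →
      (R ≤ 16 * m ^ 2 * C_P * lambdaOne μ F V C_P l₀ →
        deviationRate m C_P (lambdaOne μ F V C_P l₀) R = R ^ 2 / (32 * m ^ 2 * C_P)) ∧
      (16 * m ^ 2 * C_P * lambdaOne μ F V C_P l₀ ≤ R →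
        deviationRate m C_P (lambdaOne μ F V C_P l₀) R =
          lambdaOne μ F V C_P l₀ * R - 8 * m ^ 2 * C_P * lambdaOne μ F V C_P l₀ ^ 2)) := by
  obtain ⟨hlambdaOne, hdeviation, hrate⟩ := mainTheorem3_general M μ hinv hcont F hF hSob C_P hC
    hPoinc V hVmeas hV2 hV0 m hm l₀ hl₀ hFV
  exact ⟨hlambdaOne, fun ν _ hν t ht => (hdeviation ν hν t ht).imp_right fun h R _ => h R, hrate⟩
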